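/- Let $n\ge 1$, let $f$ be a monotone Boolean function of $x_1,\dots,x_n$ and $\varphi$ its prime CNF (the conjunction of all prime implicates of $f$), in which all of $x_1,\dots,x_n$ occur. Let $PI(f)$ be the set of prime implicants of $f$; $\psi=\bigvee_{t\in PI(f)}t$ is the prime DNF of $f$. $V(t)$ is the set of variables of $t$, $|\cdot|$ counts the terms of a DNF, and $\|\varphi\|$ is the number of literals in $\varphi$. For a term $t$, $t_i$ is the conjunction of the variables of $t$ among $x_1,\dots,x_i$. Let $\varphi_i$ consist of the clauses of $\varphi$ with all variables among $x_1,\dots,x_i$ (i.e. $\varphi$ with $x_j=1$ for $j>i$), let $f_i$ be the function it represents, and let $\Delta^i$ consist of the clauses in $\varphi_i$ but not in $\varphi_{i-1}$. Let $\Delta^i[t]$ be the CNF of all clauses $c$ such that $c$ has no variable in common with $t_{i-1}$ and $c\vee x_i$ (with $x_i\notin c$) is in $\Delta^i$, and let $\rho_{(t,i)}$ be the prime DNF of the function represented by $\Delta^i[t]$ (so $|\rho_{(t,i)}|=1$ if $\Delta^i[t]=1$, and $|\rho_{(t,i)}|=0$ if $\Delta^i[t]=0$). A term $s$ is smaller than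 $t$ if $\sum_{x_j\in V(s)}2^{n-j}<\sum_{x_j\in V(t)}2^{n-j}$. Algorithm Dualize: compute the smallest prime implicant of $f$ and put it into $Q$. While $Q\ne\emptyset$: remove the smallest $t$ from $Q$ and output it; for each $i$ with $x_i\in V(t)$ and $\Delta^i[t]\neq 1$, compute $\rho_{(t,i)}$ by a subroutine, and for each term $t'$ of $\rho_{(t,i)}$ such that $t_{i-1}\wedge t'$ is a prime implicant of $f_i$, add to $Q$ the smallest prime implicant $t^*$ of $f$ with $t^*_i=t_{i-1}\wedge t'$. Here $Q$ is stored as a binary tree of depth $n$, and time is the number of steps of a unit-cost random access machine. Let $T_{(t,i)}$ bound the time that the subroutine takes to compute $\rho_{(t,i)}$ from $\Delta^i[t]$, for $t\in PI(f)$ and $x_i\in V(t)$. Theorem. There is an absolute constant $C$ such that, for all such $n$, $f$, $\varphi$, every listing of $\varphi$ as input, and every subroutine, Algorithm Dualize terminates after having output each $t\in PI(f)$ exactly once, in increasing order, and: (a) If some clause of $\varphi$ has at least two variables, then the output delay (the time before the first output, between two consecutive outputs, and after the last output) is at most $$\max_{t\in PI(f)}\ \sum_{x_i\in V(t)}\bigl(T_{(t,i)}+|\rho_{(t,i)}|\cdot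 C\|\varphi\|\bigr),$$ and the total time is at most $$\sum_{t\in PI(f)}\ \sum_{x_i\in V(t)}\bigl(T_{(t,i)}+|\rho_{(t,i)}|\cdot C\|\varphi\|\bigr).$$ (b) In the remaining case $\varphi=x_1\wedge\dots\wedge x_n$, where all $|\rho_{(t,i)}|$ are $0$, the same two bounds hold with $C\|\varphi\|$ added. (c) $|\rho_{(t,i)}|\le|\psi|$ for all $t\in PI(f)$ and $x_i\in V(t)$. -/

import Mathlib

/-! ### Monotone Boolean functions, prime CNFs and prime DNFs

The variables are `x_0, …, x_{n-1}`, i.e. the elements of `Fin n`.  All functions below are monotone,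
so all prime implicants and prime implicates consist of positive literals; accordingly a term or a
clause is the set of the variables that occur in it, a CNF is a set of clauses and a DNF is a set of
terms.  The empty term is `1`, the empty clause is `0`, the empty CNF is `1`, the empty DNF is `0`. -/

namespace Dualization

variable {n : ℕ}

/-- `t ≤ f` for the term `t`. -/
def IsImplicant (f : (Fin n → Bool) → Bool) (t : Finset (Fin n)) : Prop :=
  ∀ v : Fin n → Bool, (∀ j ∈ t, v j = true) → f v = true

/-- `f ≤ c` for the clause `c`. -/
def IsImplicate (f : (Fin n → Bool) → Bool) (c : Finset (Fin n)) : Prop :=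
  ∀ v : Fin n → Bool, f v = true → ∃ j ∈ c, v j = true

/-- `PI(f)`, which is also the prime DNF of `f`. -/
noncomputable def primeImplicants (f : (Fin n → Bool) → Bool) : Finset (Finset (Fin n)) :=
  open Classical in Finset.univ.filter (fun t => Minimal (IsImplicant f) t)

/-- `φ` is the prime CNF of `f`: its clauses are exactly the prime implicates. -/
def IsPrimeCNF (f : (Fin n → Bool) → Bool) (φ : Finset (Finset (Fin n))) : Prop :=
  ∀ c : Finset (Fin n), c ∈ φ ↔ Minimal (IsImplicate f) c

/-- The function represented by a CNF. -/
def cnfFun (φ : Finset (Finset (Fin n))) : (Fin n → Bool) → Bool :=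
  fun v => decide (∀ c ∈ φ, ∃ j ∈ c, v j = true)

/-- The length `‖φ‖`, i.e. the number of literals. -/
def length (φ : Finset (Finset (Fin n))) : ℕ := ∑ c ∈ φ, c.card

/-- The CNF obtained from `φ` by fixing to `1` all variables but the first `k` ones. -/
def fixed (φ : Finset (Finset (Fin n))) (k : ℕ) : Finset (Finset (Fin n)) :=
  φ.filter (fun c => ∀ j ∈ c, j.val < k)

/-- `Δ^i`: the clauses that `x_i` adds, i.e. those left when the variables after `x_i` are fixed
to `1`, but not when `x_i` is fixed too. -/
def delta (φ : Finset (Finset (Fin n))) (i : Fin n) : Finset (Finset (Fin n)) :=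
  fixed φ (i.val + 1) \ fixed φ i.val

/-- `Δ^i[t]`: the clauses `c` without `x_i` such that `c ∨ x_i` is in `Δ^i` and `c` has no variable
in common with the part of `t` before `x_i`. -/
def residual (φ : Finset (Finset (Fin n))) (i : Fin n) (t : Finset (Fin n)) :
    Finset (Finset (Fin n)) :=
  ((delta φ i).image (fun c => c.erase i)).filter (fun c => Disjoint c (t.filter (fun j => j < i)))

/-- `ρ_{(t,i)}`, the prime DNF of the function represented by `Δ^i[t]`. -/
noncomputable def rho (φ : Finset (Finset (Fin n))) (t : Finset (Fin n)) (i : Fin n) :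
    Finset (Finset (Fin n)) :=
  primeImplicants (cnfFun (residual φ i t))

/-- Terms are compared as `0`-`1` vectors, lexicographically, the first variable being the most
significant one. -/
def weight (t : Finset (Fin n)) : ℕ := ∑ j ∈ t, 2 ^ (n - 1 - j.val)

/-! ### The cost model

A unit-cost random access machine.  Lists and trees are linked cells and arrays are blocks of memory.
A computation is a value together with the number of steps spent; every call of a function that
inspects its data and every pass of every loop is charged one step, as is each array access; between
two charges only a bounded number of elementary operations is executed (inspecting or allocating one
cell, comparing or copying indices and bits).  Creating an array or printing one costs its length.
Each array that is written to is used destructively: no older version of it is read afterwards. -/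

/-- The result of a computation and the number of steps that it took. -/
structure Timed (α : Type) where
  val : α
  time : ℕ

instance : Monad Timed where
  pure a := ⟨a, 0⟩
  bind x g := ⟨(g x.val).val, x.time + (g x.val).time⟩

/-- Spend `k` steps. -/
def charge (k : ℕ) : Timed Unit := ⟨(), k⟩

/-- The loop "for each `a` in `l`", with loop state `b`. -/
def loop {α β : Type} (g : β → α → Timed β) : β → List α → Timed β
  | b, [] => do
      charge 1
      return b
  | b, a :: l => do
      charge 1
      let b' ← g b a
      loop g b' l

/-- Arrays of length `n`. -/
abbrev Arr (n : ℕ) (α : Type) : Type := Fin n → α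

/-- A new array filled with `a`. -/
def Arr.new {α : Type} (n : ℕ) (a : α) : Timed (Arr n α) := do
  charge (n + 1)
  return fun _ => a

/-- Array access. -/
def Arr.get {α : Type} (A : Arr n α) (j : Fin n) : Timed α := do
  charge 1
  return A j

/-- Array update. -/
def Arr.set {α : Type} (A : Arr n α) (j : Fin n) (a : α) : Timed (Arr n α) := do
  charge 1
  return Function.update A j a

/-- The term whose characteristic vector is `A`. -/
def support (A : Arr n Bool) : Finset (Fin n) := Finset.univ.filter (fun j => A j = true)

/-- `L` lists the members of `φ` without repetitions, each as a list without repetitions. -/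
def Represents (L : List (List (Fin n))) (φ : Finset (Finset (Fin n))) : Prop :=
  (L.map List.toFinset).Nodup ∧ (∀ l ∈ L, l.Nodup) ∧ (L.map List.toFinset).toFinset = φ

/-! ### The queue

A binary tree whose leaves at depth `n` are the terms in it: the left (right) son of a node at depth
`j` holds the terms that do (do not) contain `x_j`. -/

/-- Binary trees; no node of a queue has two empty sons. -/
inductive Tree : Type
  | empty : Tree
  | leaf : Tree
  | node (left right : Tree) : Tree

/-- A node, unless both sons are empty. -/
def Tree.mk : Tree → Tree → Tree
  | .empty, .empty => .empty
  | l, r => .node l r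

/-- Insert the term with characteristic vector `A`, the variables still to be read being listed
in the second argument. -/
def Tree.insert (A : Arr n Bool) : List (Fin n) → Tree → Timed Tree
  | [], _ => do
      charge 1
      return .leaf
  | j :: js, .node l r => do
      charge 1
      if ← A.get j then
        let l' ← Tree.insert A js l
        return .node l' r
      else
        let r' ← Tree.insert A js r
        return .node l r'
  | j :: js, _ => do
      charge 1
      if ← A.get j then
        let l' ← Tree.insert A js .empty
        return .node l' .empty
      else
        let r' ← Tree.insert A js .empty
        return .node .empty r'

/-- Remove the smallest term and write it into the all-zero array `A`. -/
def Tree.popMin : List (Fin n) → Tree → Arr n Bool → Timed (Arr n Bool × Tree)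
  | j :: js, .node l .empty, A => do
      charge 1
      let A' ← A.set j true
      let (T, l') ← Tree.popMin js l A'
      return (T, Tree.mk l' .empty)
  | _ :: js, .node l r, A => do
      charge 1
      let (T, r') ← Tree.popMin js r A
      return (T, Tree.mk l r')
  | _, _, A => do
      charge 1
      return (A, .empty)

/-! ### Algorithm Dualize -/

/-- The last variable of a clause. -/
def lastVar (c : List (Fin n)) : Timed (Option (Fin n)) :=
  loop (fun m j => do
    match m with
    | none => return some j
    | some k => return some (if k < j then j else k)) none c

/-- Sort the clauses of the input by their last variable: entry `i` of the result lists `Δ^i`. -/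
def buckets (L : List (List (Fin n))) : Timed (Arr n (List (List (Fin n)))) := do
  let B ← Arr.new n []
  loop (fun B c => do
    match ← lastVar c with
    | none => return B
    | some i =>
        let l ← B.get i
        B.set i (c :: l)) B L

/-- Does the term `A` contain a variable of the clause `c`? -/
def hits (A : Arr n Bool) (c : List (Fin n)) : Timed Bool :=
  loop (fun h j => do
    let b ← A.get j
    return h || b) false c

/-- Extend the term `A` to its smallest completion: from the variable with index `k` on, variables are
added only if they are needed for some clause in which they are the last variable. -/
def complete (B : Arr n (List (List (Fin n)))) (k : ℕ) (A : Arr n Bool) : Timed (Arr n Bool) :=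
  loop (fun A j => do
    if k ≤ j.val then
      let l ← B.get j
      let needed ← loop (fun b c => do
        let h ← hits A c
        return b || !h) false l
      if needed then A.set j true else return A
    else return A) A (List.finRange n)

/-- Build `Δ^i[t]` for the term `A` of `t`. -/
def buildResidual (B : Arr n (List (List (Fin n)))) (A : Arr n Bool) (i : Fin n) :
    Timed (List (List (Fin n))) := do
  let l ← B.get i
  loop (fun Γ c => do
    let (h, c') ← loop (fun (p : Bool × List (Fin n)) j => do
      if j = i then return p
      else
        let b ← A.get j
        return (p.1 || b, j :: p.2)) (false, []) c
    if h then return Γ else return (c' :: Γ)) [] l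

/-- The conjunction of the part of the term `A` before `x_i` and the term `t'`, in a new array. -/
def merge (A : Arr n Bool) (i : Fin n) (t' : List (Fin n)) : Timed (Arr n Bool) := do
  let S ← Arr.new n false
  let S ← loop (fun S j => do
    if j < i then
      let b ← A.get j
      S.set j b
    else return S) S (List.finRange n)
  loop (fun S j => S.set j true) S t'

/-- Is the term `S`, whose variables precede `x_i`, a prime implicant of the function that
results when the variables after `x_i` are fixed to `1`?  Every clause up to `Δ^i` must contain
a variable of `S`, and every variable of `S` must be the only one of `S` in some clause. -/
def isPrime (B : Arr n (List (List (Fin n)))) (S : Arr n Bool) (i : Fin n) : Timed Bool := do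
  let P ← Arr.new n false
  let (ok, P) ← loop (fun (s : Bool × Arr n Bool) k => do
    if k ≤ i then
      let l ← B.get k
      loop (fun (s : Bool × Arr n Bool) c => do
        let found ← loop (fun (h : List (Fin n)) j => do
          if ← S.get j then return j :: h else return h) [] c
        match found with
        | [] => return (false, s.2)
        | [j] =>
            let P' ← s.2.set j true
            return (s.1, P')
        | _ => return s) s l
    else return s) (true, P) (List.finRange n)
  loop (fun ok j => do
    let b ← S.get j
    let p ← P.get j
    return ok && (!b || p)) ok (List.finRange n)

/-- Step 1: preprocess the input, compute the smallest prime implicant and put it into the queue. -/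
def start (L : List (List (Fin n))) : Timed (Arr n (List (List (Fin n))) × Tree) := do
  let B ← buckets L
  let Z ← Arr.new n false
  let A ← complete B 0 Z
  let Q ← Tree.insert A (List.finRange n) .empty
  return (B, Q)

/-- First part of a pass of step 2: remove the smallest term from the nonempty queue and print it. -/
def emit (n : ℕ) (Q : Tree) : Timed (Arr n Bool × Tree) := do
  charge 1
  let Z ← Arr.new n false
  let p ← Tree.popMin (List.finRange n) Q Z
  charge n
  return p

/-- The rest of a pass of step 2 for the term `A`; `D` is the subroutine that is called to compute
the prime DNF of `Δ^i[t]`. -/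
def process (B : Arr n (List (List (Fin n))))
    (D : List (List (Fin n)) → Timed (List (List (Fin n))))
    (A : Arr n Bool) (Q : Tree) : Timed Tree :=
  loop (fun Q i => do
    if ← A.get i then
      match ← buildResidual B A i with
      | [] => return Q
      | c :: Γ =>
          let ρ ← D (c :: Γ)
          loop (fun Q t' => do
            let S ← merge A i t'
            if ← isPrime B S i then
              let A' ← complete B (i.val + 1) S
              Tree.insert A' (List.finRange n) Q
            else return Q) Q ρ
    else return Q) Q (List.finRange n)

/-- `Loop B D Q clock out total`: step 2, started with queue `Q` when `clock` steps have been
made, prints the terms in `out`, in this order and each with the number of steps made up to then,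
and terminates after `total` steps. -/
inductive Loop (B : Arr n (List (List (Fin n))))
    (D : List (List (Fin n)) → Timed (List (List (Fin n)))) :
    Tree → ℕ → List (ℕ × Finset (Fin n)) → ℕ → Prop
  | halt (clock : ℕ) : Loop B D .empty clock [] (clock + 1)
  | pass (Q : Tree) (clock : ℕ) (out : List (ℕ × Finset (Fin n))) (total : ℕ) (hQ : Q ≠ .empty)
      (h : Loop B D (process B D (emit n Q).val.1 (emit n Q).val.2).val
        (clock + (emit n Q).time + (process B D (emit n Q).val.1 (emit n Q).val.2).time) out total) :
      Loop B D Q clock ((clock + (emit n Q).time, support (emit n Q).val.1) :: out) total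

/-- Algorithm Dualize with the subroutine `D`, run on the list `L` of clauses, prints `out` (with time
stamps) and terminates after `total` steps. -/
def DualizeRun (L : List (List (Fin n)))
    (D : List (List (Fin n)) → Timed (List (List (Fin n))))
    (out : List (ℕ × Finset (Fin n))) (total : ℕ) : Prop :=
  Loop (start L).val.1 D (start L).val.2 (start L).time out total

/-- The output delay is at most `M`: at most `M` steps are made before the first output, between two
consecutive outputs, and after the last output. -/
def DelayAtMost (M : ℕ) (out : List (ℕ × Finset (Fin n))) (total : ℕ) : Prop :=
  List.IsChain (fun a b => b ≤ a + M) ((0 :: out.map Prod.fst) ++ [total])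

/-- `∑_{x_i ∈ V(t)} (T_{(t,i)} + |ρ_{(t,i)}| · C · ‖φ‖)`. -/
noncomputable def passBound (φ : Finset (Finset (Fin n))) (T : Finset (Fin n) → Fin n → ℕ) (C : ℕ)
    (t : Finset (Fin n)) : ℕ :=
  ∑ i ∈ t, (T t i + (rho φ t i).card * (C * length φ))

end Dualization

/-! Correctness. Prime implicants of `f` are the minimal transversals of the clauses of `φ`, and a
transversal is minimal iff each of its variables has a private clause, one that meets it in that
variable only (`minimal_isTransversal_iff`). This local criterion also applies to prefixes:
`PrefixMin φ m t` says that the part of `t` among the first `m` variables is minimal for the clauses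
within them. Greedy completion preserves it and is unique (`IsCompletion.prefixMin`,
`IsCompletion.eq`); that the completion is the smallest one is not needed.

The core is `isCompletion_empty_or_exists_generates`. If all prefixes of `t` are minimal, `t` is the
greedy completion of the empty term. Otherwise take the last prefix that is not minimal and let
`x_i` be the next variable. Then `i ∉ t`; shrink the part of `t` before `x_i` to a minimal
transversal `s`, add `x_i` and complete greedily to `u`. The discarded variables form a term of
`ρ_{(u,i)}`, so processing `u` regenerates `t`. Generated terms are strictly larger than their
source (`Generates.weight_lt`). Hence, with a queue that returns its minimum, the terms come out in
increasing order, none is missed, and the run ends (`exists_loop`).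

Time. Every clause lies in at most one bucket `Δ^i`, so one sweep over all buckets is linear in the
input (`sum_cells_buckets_le`), and `n ≤ ‖φ‖` because every variable occurs. Thus each term of
`ρ_{(t,i)}` costs `O(‖φ‖)`, and each pass and the preprocessing have `O(‖φ‖)` overhead. If some
clause has two variables, every prime implicant has some `|ρ_{(t,i)}| ≥ 1` (`one_le_sum_card_rho`),
and a larger `C` absorbs the overhead; otherwise there is a single prime implicant and the overhead
is paid by the added `C‖φ‖`.

Part (c) comes from an injection of `ρ_{(t,i)}` into the prime implicants (`card_rho_le`). -/

namespace Dualization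

variable {n : ℕ}

/-! ### Transversals -/

/-- The term `t` has a variable in common with each clause of `ψ`. -/
def IsTransversal (ψ : Finset (Finset (Fin n))) (t : Finset (Fin n)) : Prop :=
  ∀ c ∈ ψ, ∃ j ∈ c, j ∈ t

/-- Deleting `v` destroys transversality exactly when some clause meets `t` in `v` alone; this
private clause certifies that `v` is needed. -/
theorem minimal_isTransversal_iff {ψ : Finset (Finset (Fin n))} {t : Finset (Fin n)} :
    Minimal (IsTransversal ψ) t ↔
      IsTransversal ψ t ∧ ∀ v ∈ t, ∃ c ∈ ψ, v ∈ c ∧ ∀ x ∈ c, x ∈ t → x = v := by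
  constructor
  · rintro ⟨ht, hmin⟩
    refine ⟨ht, fun v hv => ?_⟩
    by_contra! hcon
    have : IsTransversal ψ (t.erase v) := by
      intro c hc
      by_cases hvc : v ∈ c
      · obtain ⟨x, hx, hxt, hxv⟩ := hcon c hc hvc
        exact ⟨x, hx, Finset.mem_erase.2 ⟨hxv, hxt⟩⟩
      · obtain ⟨x, hx, hxt⟩ := ht c hc
        exact ⟨x, hx, Finset.mem_erase.2 ⟨fun h => hvc (h ▸ hx), hxt⟩⟩
    exact Finset.notMem_erase v t (hmin this (Finset.erase_subset _ _) hv)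
  · rintro ⟨ht, hpriv⟩
    refine ⟨ht, fun s hs hst v hv => ?_⟩
    obtain ⟨c, hc, -, hx⟩ := hpriv v hv
    obtain ⟨x, hxc, hxs⟩ := hs c hc
    exact hx x hxc (hst hxs) ▸ hxs

theorem IsTransversal.exists_minimal {ψ : Finset (Finset (Fin n))} {t : Finset (Fin n)}
    (h : IsTransversal ψ t) : ∃ s ⊆ t, Minimal (IsTransversal ψ) s := by
  obtain ⟨s, hs, hm⟩ := exists_minimal_le_of_wellFoundedLT (IsTransversal ψ) t h
  exact ⟨s, hs, hm⟩

theorem isImplicant_cnfFun (ψ : Finset (Finset (Fin n))) :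
    IsImplicant (cnfFun ψ) = IsTransversal ψ := by
  funext t
  apply propext
  constructor
  · intro h c hc
    have := h (fun j => decide (j ∈ t)) (by simp)
    simp only [cnfFun, decide_eq_true_eq] at this
    exact this c hc
  · intro h v hv
    simp only [cnfFun, decide_eq_true_eq]
    intro c hc
    obtain ⟨j, hj, ht⟩ := h c hc
    exact ⟨j, hj, hv j ht⟩

theorem mem_primeImplicants_cnfFun {ψ : Finset (Finset (Fin n))} {t : Finset (Fin n)} :
    t ∈ primeImplicants (cnfFun ψ) ↔ Minimal (IsTransversal ψ) t := by
  simp [primeImplicants, isImplicant_cnfFun]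

/-- If `f v` is false, monotonicity makes the variables that are false under `v` an implicate; a
prime implicate inside it is a clause that `v` violates. -/
theorem IsPrimeCNF.eq_cnfFun {f : (Fin n → Bool) → Bool} (hf : Monotone f)
    {φ : Finset (Finset (Fin n))} (hφ : IsPrimeCNF f φ) : f = cnfFun φ := by
  funext v
  rw [Bool.eq_iff_iff]
  simp only [cnfFun, decide_eq_true_eq]
  constructor
  · intro h c hc
    exact ((hφ c).1 hc).1 v h
  · intro h
    by_contra hv
    have himp : IsImplicate f (Finset.univ.filter (fun j => v j = false)) := by
      intro w hw
      by_contra! hcon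
      apply hv
      have hle : w ≤ v := by
        intro j
        by_cases hj : v j = false
        · simp [hcon j (by simp [hj])]
        · simp [Bool.not_eq_false _ ▸ hj, Bool.le_true]
      have := hf hle
      rw [hw] at this
      exact top_le_iff.1 this
    obtain ⟨c, hc, hm⟩ := exists_minimal_le_of_wellFoundedLT (IsImplicate f) _ himp
    obtain ⟨j, hj, hvj⟩ := h c ((hφ c).2 hm)
    have := Finset.mem_filter.1 (hc hj)
    simp [hvj] at this

/-! ### Clauses in the first variables, and minimality of prefixes -/

theorem mem_fixed {φ : Finset (Finset (Fin n))} {k : ℕ} {c : Finset (Fin n)} :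
    c ∈ fixed φ k ↔ c ∈ φ ∧ ∀ j ∈ c, j.val < k := by
  simp [fixed]

theorem mem_delta {φ : Finset (Finset (Fin n))} {i : Fin n} {c : Finset (Fin n)} :
    c ∈ delta φ i ↔ c ∈ φ ∧ i ∈ c ∧ ∀ j ∈ c, j ≤ i := by
  simp only [delta, Finset.mem_sdiff, mem_fixed]
  constructor
  · rintro ⟨⟨hc, h1⟩, h2⟩
    refine ⟨hc, ?_, fun j hj => Nat.lt_succ_iff.1 (h1 j hj)⟩
    by_contra hi
    refine h2 ⟨hc, fun j hj => lt_of_le_of_ne (Nat.lt_succ_iff.1 (h1 j hj)) fun e => ?_⟩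
    exact hi (Fin.ext e ▸ hj)
  · rintro ⟨hc, hi, h⟩
    exact ⟨⟨hc, fun j hj => Nat.lt_succ_iff.2 (h j hj)⟩, fun h2 => (h2.2 i hi).false⟩

theorem mem_fixed_succ {φ : Finset (Finset (Fin n))} {i : Fin n} {c : Finset (Fin n)} :
    c ∈ fixed φ (i.val + 1) ↔ c ∈ fixed φ i.val ∨ c ∈ delta φ i := by
  have hsub : c ∈ fixed φ i.val → c ∈ fixed φ (i.val + 1) := fun h =>
    mem_fixed.2 ⟨(mem_fixed.1 h).1, fun j hj => ((mem_fixed.1 h).2 j hj).trans (Nat.lt_succ_self _)⟩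
  simp only [delta, Finset.mem_sdiff]
  tauto

theorem fixed_self (φ : Finset (Finset (Fin n))) : fixed φ n = φ := by
  ext c
  simp [mem_fixed]

/-- The part of `u` among the first `m` variables is a minimal transversal of the clauses in them. -/
def PrefixMin (φ : Finset (Finset (Fin n))) (m : ℕ) (u : Finset (Fin n)) : Prop :=
  IsTransversal (fixed φ m) u ∧
    ∀ v ∈ u, v.val < m → ∃ c ∈ fixed φ m, v ∈ c ∧ ∀ x ∈ c, x ∈ u → x = v

theorem PrefixMin.congr {φ : Finset (Finset (Fin n))} {m : ℕ} {s u : Finset (Fin n)}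
    (h : PrefixMin φ m s) (hsu : ∀ j : Fin n, j.val < m → (j ∈ u ↔ j ∈ s)) : PrefixMin φ m u := by
  refine ⟨fun c hc => ?_, fun v hv hvm => ?_⟩
  · obtain ⟨j, hj, hs⟩ := h.1 c hc
    exact ⟨j, hj, (hsu j ((mem_fixed.1 hc).2 j hj)).2 hs⟩
  · obtain ⟨c, hc, hvc, hx⟩ := h.2 v ((hsu v hvm).1 hv) hvm
    exact ⟨c, hc, hvc, fun x hxc hxu => hx x hxc ((hsu x ((mem_fixed.1 hc).2 x hxc)).1 hxu)⟩

theorem minimal_fixed_iff_prefixMin {φ : Finset (Finset (Fin n))} {m : ℕ} {u : Finset (Fin n)}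
    (hu : ∀ j ∈ u, j.val < m) : Minimal (IsTransversal (fixed φ m)) u ↔ PrefixMin φ m u := by
  rw [minimal_isTransversal_iff]
  exact and_congr_right fun _ => forall₂_congr fun v hv => by simp [hu v hv]

theorem minimal_iff_prefixMin {φ : Finset (Finset (Fin n))} {u : Finset (Fin n)} :
    Minimal (IsTransversal φ) u ↔ PrefixMin φ n u := by
  conv_lhs => rw [← fixed_self φ]
  exact minimal_fixed_iff_prefixMin fun j _ => j.isLt

/-! ### Smallest completions -/

/-- `u` arises from the part of `s` among the first `k` variables by adding, in increasing order, those
of the other variables that are needed for a clause in which they are the last variable. -/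
def IsCompletion (φ : Finset (Finset (Fin n))) (k : ℕ) (s u : Finset (Fin n)) : Prop :=
  (∀ j : Fin n, j.val < k → (j ∈ u ↔ j ∈ s)) ∧
    ∀ j : Fin n, k ≤ j.val → (j ∈ u ↔ ∃ c ∈ delta φ j, ∀ x ∈ c, x < j → x ∉ u)

/-- The greedy rule decides each variable from the smaller ones alone. -/
theorem IsCompletion.eq {φ : Finset (Finset (Fin n))} {k : ℕ} {s u w : Finset (Fin n)}
    (hu : IsCompletion φ k s u) (hw : IsCompletion φ k s w) : u = w := by
  have : ∀ m : ℕ, ∀ j : Fin n, j.val = m → (j ∈ u ↔ j ∈ w) := by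
    intro m
    induction m using Nat.strong_induction_on with
    | _ m ih =>
      rintro j rfl
      by_cases hj : j.val < k
      · rw [hu.1 j hj, hw.1 j hj]
      · rw [hu.2 j (not_lt.1 hj), hw.2 j (not_lt.1 hj)]
        refine exists_congr fun c => and_congr_right fun _ => forall₂_congr fun x _ => ?_
        exact forall_congr' fun hx => not_congr (ih x.val hx x rfl)
  ext j
  exact this _ j rfl

/-- Downward induction on `k`: decide the variable with index `k` by the greedy rule and let the
completion from `k + 1` do the rest. -/
theorem exists_isCompletion (φ : Finset (Finset (Fin n))) {k : ℕ} (hk : k ≤ n) (s : Finset (Fin n)) :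
    ∃ u, IsCompletion φ k s u := by
  induction hk using Nat.decreasingInduction generalizing s with
  | self => exact ⟨s, fun _ _ => Iff.rfl, fun j hj => absurd j.isLt (not_lt.2 hj)⟩
  | of_succ k hk ih =>
    classical
    let i : Fin n := ⟨k, hk⟩
    obtain ⟨u, hu⟩ := ih (if ∃ c ∈ delta φ i, ∀ x ∈ c, x < i → x ∉ s then insert i s else s.erase i)
    have hlt : ∀ j : Fin n, j.val < k → (j ∈ u ↔ j ∈ s) := by
      intro j hj
      have hji : j ≠ i := fun h => by simp [h, i] at hj
      rw [hu.1 j (by omega)]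
      split_ifs <;> simp [hji]
    refine ⟨u, hlt, fun j hj => ?_⟩
    by_cases hjk : j = i
    · subst hjk
      rw [hu.1 i (Nat.lt_succ_self k)]
      have : (∃ c ∈ delta φ i, ∀ x ∈ c, x < i → x ∉ u) ↔
          ∃ c ∈ delta φ i, ∀ x ∈ c, x < i → x ∉ s :=
        exists_congr fun c => and_congr_right fun _ => forall₂_congr fun x _ =>
          forall_congr' fun hx => not_congr (hlt x hx)
      rw [this]
      split_ifs with h <;> simp [h]
    · exact hu.2 j (Nat.lt_of_le_of_ne hj fun h => hjk (Fin.ext h.symm))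

/-- A clause with last variable `x_i` that is still missed forces `x_i` in and is then private to
it; private clauses of earlier variables do not contain `x_i` and stay private. -/
theorem IsCompletion.prefixMin {φ : Finset (Finset (Fin n))} {k : ℕ} {s u : Finset (Fin n)}
    (hu : IsCompletion φ k s u) (hs : PrefixMin φ k s) {m : ℕ} (hkm : k ≤ m) (hm : m ≤ n) :
    PrefixMin φ m u := by
  induction m, hkm using Nat.le_induction with
  | base => exact hs.congr hu.1
  | succ m hkm ih =>
    have ih := ih (by omega)
    let i : Fin n := ⟨m, hm⟩
    have hiu := hu.2 i hkm
    refine ⟨fun c hc => ?_, fun v hv hvm => ?_⟩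
    · rcases (mem_fixed_succ (i := i)).1 hc with hc | hc
      · exact ih.1 c hc
      · by_cases hi : i ∈ u
        · exact ⟨i, (mem_delta.1 hc).2.1, hi⟩
        · have := mt hiu.2 hi
          push Not at this
          obtain ⟨x, hx, -, hxu⟩ := this c hc
          exact ⟨x, hx, hxu⟩
    · by_cases hvi : v = i
      · subst hvi
        obtain ⟨c, hc, hx⟩ := hiu.1 hv
        obtain ⟨-, hic, hle⟩ := mem_delta.1 hc
        exact ⟨c, mem_fixed_succ.2 (Or.inr hc), hic, fun x hxc hxu =>
          ((hle x hxc).lt_or_eq).resolve_left fun h => hx x hxc h hxu⟩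
      · obtain ⟨c, hc, h⟩ := ih.2 v hv
          (lt_of_le_of_ne (Nat.lt_succ_iff.1 hvm) fun h => hvi (Fin.ext h))
        exact ⟨c, (mem_fixed_succ (i := i)).2 (Or.inl hc), h⟩

/-- Among the clauses in variables up to `x_j`, a private clause of `x_j` has `x_j` as its last
variable, which triggers the greedy rule; conversely, a clause of `Δ^j` missed before `x_j` must be
hit at `x_j`. -/
theorem isCompletion_self {φ : Finset (Finset (Fin n))} {k : ℕ} {t : Finset (Fin n)}
    (ht : ∀ m, k ≤ m → m ≤ n → PrefixMin φ m t) : IsCompletion φ k t t := by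
  refine ⟨fun _ _ => Iff.rfl, fun j hj => ?_⟩
  have hp := ht (j.val + 1) (by omega) j.isLt
  constructor
  · intro hjt
    obtain ⟨c, hc, hjc, hx⟩ := hp.2 j hjt (Nat.lt_succ_self _)
    refine ⟨c, mem_delta.2 ⟨(mem_fixed.1 hc).1, hjc, fun x hxc =>
      Nat.lt_succ_iff.1 ((mem_fixed.1 hc).2 x hxc)⟩, fun x hxc hxj hxt => ?_⟩
    exact hxj.ne (hx x hxc hxt)
  · rintro ⟨c, hc, hx⟩
    obtain ⟨x, hxc, hxt⟩ := hp.1 c (mem_fixed_succ.2 (Or.inr hc))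
    rcases ((mem_delta.1 hc).2.2 x hxc).lt_or_eq with h | h
    · exact absurd hxt (hx x hxc h)
    · exact h ▸ hxt

/-! ### The order of terms -/

/-- The power of two at `j` exceeds the sum of all distinct smaller powers. -/
theorem weight_lt_of_first_difference {s t : Finset (Fin n)} {j : Fin n} (hs : j ∉ s) (ht : j ∈ t)
    (hst : ∀ x, x < j → (x ∈ s ↔ x ∈ t)) : weight s < weight t := by
  have hsplit : ∀ r : Finset (Fin n), weight r = ∑ x ∈ r.filter (· < j), 2 ^ (n - 1 - x.val) +
      ∑ x ∈ r.filter (¬ · < j), 2 ^ (n - 1 - x.val) := fun r =>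
    (Finset.sum_filter_add_sum_filter_not r _ _).symm
  have hlow : s.filter (· < j) = t.filter (· < j) := by
    ext x
    simp only [Finset.mem_filter]
    exact ⟨fun h => ⟨(hst x h.2).1 h.1, h.2⟩, fun h => ⟨(hst x h.2).2 h.1, h.2⟩⟩
  rw [hsplit s, hsplit t, hlow]
  apply Nat.add_lt_add_left
  have hinj : Set.InjOn (fun x : Fin n => n - 1 - x.val) (s.filter (¬ · < j)) := by
    intro x _ y _ h
    have := x.isLt
    have := y.isLt
    apply Fin.ext
    simp only at h
    omega
  calc ∑ x ∈ s.filter (¬ · < j), 2 ^ (n - 1 - x.val)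
      = ∑ k ∈ (s.filter (¬ · < j)).image (fun x : Fin n => n - 1 - x.val), 2 ^ k :=
        (Finset.sum_image hinj).symm
    _ < 2 ^ (n - 1 - j.val) := by
        apply Nat.geomSum_lt le_rfl
        intro k hk
        obtain ⟨x, hx, rfl⟩ := Finset.mem_image.1 hk
        obtain ⟨hxs, hxj⟩ := Finset.mem_filter.1 hx
        have hne : x ≠ j := fun h => hs (h ▸ hxs)
        have h1 : j.val < x.val := lt_of_le_of_ne (not_lt.1 hxj) fun h => hne (Fin.ext h.symm)
        have := x.isLt
        omega
    _ ≤ ∑ x ∈ t.filter (¬ · < j), 2 ^ (n - 1 - x.val) :=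
        Finset.single_le_sum (f := fun x : Fin n => 2 ^ (n - 1 - x.val)) (fun _ _ => Nat.zero_le _)
          (Finset.mem_filter.2 ⟨ht, lt_irrefl j⟩)

theorem weight_lt_of_prefix_ssubset {s t : Finset (Fin n)} {i : Fin n}
    (hst : ∀ x, x < i → x ∈ s → x ∈ t) (hne : ∃ x, x < i ∧ x ∈ t ∧ x ∉ s) :
    weight s < weight t := by
  obtain ⟨j, ⟨hji, hjt, hjs⟩, hmin⟩ := WellFounded.has_min (wellFounded_lt (α := Fin n))
    {x | x < i ∧ x ∈ t ∧ x ∉ s} hne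
  refine weight_lt_of_first_difference hjs hjt fun x hx => ⟨hst x (hx.trans hji), fun hxt => ?_⟩
  by_contra hxs
  exact hmin x ⟨hx.trans hji, hxt, hxs⟩ hx

/-! ### Generation of prime implicants -/

/-- Clauses of `Δ^i` have last variable `x_i`, so erasing `i` leaves precisely the part before
`x_i`. This form avoids images and erasures. -/
theorem isTransversal_residual_iff {φ : Finset (Finset (Fin n))} {i : Fin n}
    {t r : Finset (Fin n)} : IsTransversal (residual φ i t) r ↔
      ∀ c ∈ delta φ i, (∀ x ∈ c, x < i → x ∉ t) → ∃ x ∈ c, x < i ∧ x ∈ r := by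
  have hlt : ∀ c ∈ delta φ i, ∀ x, x ∈ c.erase i ↔ x ∈ c ∧ x < i := by
    intro c hc x
    rw [Finset.mem_erase]
    exact ⟨fun h => ⟨h.2, ((mem_delta.1 hc).2.2 x h.2).lt_of_ne h.1⟩, fun h => ⟨h.2.ne, h.1⟩⟩
  simp only [IsTransversal, residual, Finset.mem_filter, Finset.mem_image, and_imp,
    forall_exists_index, forall_apply_eq_imp_iff₂]
  refine forall₂_congr fun c hc => ?_
  refine imp_congr ?_ ?_
  · simp only [Finset.disjoint_left, hlt c hc, Finset.mem_filter]
    exact forall_congr' fun x => by tauto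
  · simp only [hlt c hc, and_assoc]

theorem residual_nonempty_iff {φ : Finset (Finset (Fin n))} {i : Fin n} {t : Finset (Fin n)} :
    (residual φ i t).Nonempty ↔ ∃ c ∈ delta φ i, ∀ x ∈ c, x < i → x ∉ t := by
  rw [← not_iff_not, Finset.not_nonempty_iff_eq_empty]
  constructor
  · intro h
    have h0 : IsTransversal (residual φ i t) ∅ := by simp [IsTransversal, h]
    rw [isTransversal_residual_iff] at h0
    rintro ⟨c, hc, hx⟩
    simpa using h0 c hc hx
  · intro h
    by_contra hne
    have h0 : IsTransversal (residual φ i t) ∅ :=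
      isTransversal_residual_iff.2 fun c hc hx => (h ⟨c, hc, hx⟩).elim
    obtain ⟨c, hc⟩ := Finset.nonempty_iff_ne_empty.2 hne
    simpa using h0 c hc

theorem mem_rho {φ : Finset (Finset (Fin n))} {i : Fin n} {t r : Finset (Fin n)} :
    r ∈ rho φ t i ↔ Minimal (IsTransversal (residual φ i t)) r :=
  mem_primeImplicants_cnfFun

/-- A private clause of `x` in `Δ^i[t]` consists of variables before `x_i` that are not in `t`. -/
theorem lt_and_notMem_of_mem_rho {φ : Finset (Finset (Fin n))} {i : Fin n} {t r : Finset (Fin n)}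
    (hr : r ∈ rho φ t i) {x : Fin n} (hx : x ∈ r) : x < i ∧ x ∉ t := by
  obtain ⟨c, hc, hxc, -⟩ := (minimal_isTransversal_iff.1 (mem_rho.1 hr)).2 x hx
  simp only [residual, Finset.mem_filter, Finset.mem_image] at hc
  obtain ⟨⟨c, hcd, rfl⟩, hdisj⟩ := hc
  obtain ⟨hxi, hxc'⟩ := Finset.mem_erase.1 hxc
  have hlt : x < i := ((mem_delta.1 hcd).2.2 x hxc').lt_of_ne hxi
  exact ⟨hlt, fun hxt => Finset.disjoint_left.1 hdisj hxc (Finset.mem_filter.2 ⟨hxt, hlt⟩)⟩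

/-- Starting with `t`, the pair `i`, `r` makes the algorithm put `u` into the queue. -/
def GeneratesVia (φ : Finset (Finset (Fin n))) (t : Finset (Fin n)) (i : Fin n)
    (r u : Finset (Fin n)) : Prop :=
  (residual φ i t).Nonempty ∧
    Minimal (IsTransversal (fixed φ (i.val + 1))) (t.filter (· < i) ∪ r) ∧
    IsCompletion φ (i.val + 1) (t.filter (· < i) ∪ r) u

/-- Processing `t` puts `u` into the queue. -/
def Generates (φ : Finset (Finset (Fin n))) (t u : Finset (Fin n)) : Prop :=
  ∃ i ∈ t, ∃ r ∈ rho φ t i, GeneratesVia φ t i r u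

theorem Generates.minimal {φ : Finset (Finset (Fin n))} {t u : Finset (Fin n)}
    (h : Generates φ t u) : Minimal (IsTransversal φ) u := by
  obtain ⟨i, -, r, hr, -, hmin, hcomp⟩ := h
  rw [minimal_iff_prefixMin]
  refine hcomp.prefixMin ((minimal_fixed_iff_prefixMin fun j hj => ?_).1 hmin) i.isLt le_rfl
  rcases Finset.mem_union.1 hj with hj | hj
  · exact Nat.lt_succ_of_lt (Finset.mem_filter.1 hj).2
  · exact Nat.lt_succ_of_lt (lt_and_notMem_of_mem_rho hr hj).1

/-- Since `Δ^i[t]` has a clause, `r` is nonempty; it lies before `x_i` and outside `t`. So before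
`x_i` the new term strictly contains the old one. -/
theorem Generates.weight_lt {φ : Finset (Finset (Fin n))} {t u : Finset (Fin n)}
    (h : Generates φ t u) : weight t < weight u := by
  obtain ⟨i, -, r, hr, ⟨c, hc⟩, -, hcomp⟩ := h
  obtain ⟨x, -, hxr⟩ := (mem_rho.1 hr).1 c hc
  obtain ⟨hxi, hxt⟩ := lt_and_notMem_of_mem_rho hr hxr
  refine weight_lt_of_prefix_ssubset (i := i) (fun y hy hyt => ?_) ⟨x, hxi, ?_, hxt⟩
  · exact (hcomp.1 y (Nat.lt_succ_of_lt hy)).2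
      (Finset.mem_union_left _ (Finset.mem_filter.2 ⟨hyt, hy⟩))
  · exact (hcomp.1 x (Nat.lt_succ_of_lt hxi)).2 (Finset.mem_union_right _ hxr)

/-- Every minimal transversal but the smallest one is generated by another one. -/
theorem isCompletion_empty_or_exists_generates {φ : Finset (Finset (Fin n))} {t : Finset (Fin n)}
    (ht : Minimal (IsTransversal φ) t) :
    IsCompletion φ 0 ∅ t ∨ ∃ s, Minimal (IsTransversal φ) s ∧ Generates φ s t := by
  classical
  have htn := minimal_iff_prefixMin.1 ht
  by_cases hall : ∀ m, m ≤ n → PrefixMin φ m t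
  · left
    have := isCompletion_self (k := 0) fun m _ hm => hall m hm
    exact ⟨fun j hj => absurd hj (Nat.not_lt_zero _), this.2⟩
  right
  push Not at hall
  obtain ⟨m₀, hm₀, hbad₀⟩ := hall
  -- `m` is the length of the last prefix that fails to be minimal; the variable `i` of index `m`
  -- comes right after it.
  let m := Nat.findGreatest (fun m => ¬ PrefixMin φ m t) n
  have hbad : ¬ PrefixMin φ m t :=
    Nat.findGreatest_spec (P := fun m => ¬ PrefixMin φ m t) hm₀ hbad₀
  have hgood : ∀ k, m + 1 ≤ k → k ≤ n → PrefixMin φ k t := fun k hk hkn =>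
    not_not.1 (Nat.findGreatest_is_greatest (P := fun m => ¬ PrefixMin φ m t) hk hkn)
  have hmle : m ≤ n := Nat.findGreatest_le n
  clear_value m
  have hmn : m < n := hmle.lt_of_ne fun h => hbad (by rw [h]; exact htn)
  let i : Fin n := ⟨m, hmn⟩
  have hcompt : IsCompletion φ (i.val + 1) t t := isCompletion_self hgood
  have hp : PrefixMin φ (i.val + 1) t := hgood _ le_rfl hmn
  have htrans : IsTransversal (fixed φ i.val) t := fun c hc => hp.1 c (mem_fixed_succ.2 (Or.inl hc))
  -- If `i ∈ t`, no clause of `Δ^i` is private to an earlier variable, so the prefix of length `m`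
  -- would already be minimal.
  have hit : i ∉ t := by
    intro hit
    refine hbad ⟨htrans, fun v hv hvm => ?_⟩
    obtain ⟨c, hc, hvc, hx⟩ := hp.2 v hv (Nat.lt_succ_of_lt hvm)
    refine ⟨c, (mem_fixed_succ.1 hc).resolve_right fun hcd => ?_, hvc, hx⟩
    have := hx i (mem_delta.1 hcd).2.1 hit
    rw [← this] at hvm
    exact hvm.false
  have htrans' : IsTransversal (fixed φ i.val) (t.filter (· < i)) := fun c hc =>
    let ⟨x, hx, hxt⟩ := htrans c hc
    ⟨x, hx, Finset.mem_filter.2 ⟨hxt, (mem_fixed.1 hc).2 x hx⟩⟩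
  obtain ⟨s, hst, hs⟩ := htrans'.exists_minimal
  have hslt : ∀ x ∈ s, x < i := fun x hx => (Finset.mem_filter.1 (hst hx)).2
  have hst' : s ⊆ t := hst.trans (Finset.filter_subset _ _)
  have hsp : PrefixMin φ i.val s := (minimal_fixed_iff_prefixMin hslt).1 hs
  obtain ⟨y, hyt, hyi, hys⟩ : ∃ y ∈ t, y < i ∧ y ∉ s := by
    by_contra! hcon
    exact hbad (hsp.congr fun j hj => ⟨fun h => hcon j h hj, fun h => hst' h⟩)
  -- A private clause `d` of the discarded `y` misses `s`. As `s` hits all clauses before `x_i`, `d`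
  -- lies in `Δ^i`, and it becomes the private clause of `i` in `insert i s`.
  obtain ⟨d, hd, hyd, hydx⟩ := hp.2 y hyt (Nat.lt_succ_of_lt hyi)
  have hds : ∀ x ∈ d, x ∉ s := fun x hx hxs => by
    rw [hydx x hx (hst' hxs)] at hxs
    exact hys hxs
  have hdd : d ∈ delta φ i := (mem_fixed_succ.1 hd).resolve_left fun hdf =>
    let ⟨x, hx, hxs⟩ := hs.1 d hdf
    hds x hx hxs
  have hsi : PrefixMin φ (i.val + 1) (insert i s) := by
    refine ⟨fun c hc => ?_, fun v hv _ => ?_⟩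
    · rcases mem_fixed_succ.1 hc with hc | hc
      · obtain ⟨x, hx, hxs⟩ := hs.1 c hc
        exact ⟨x, hx, Finset.mem_insert_of_mem hxs⟩
      · exact ⟨i, (mem_delta.1 hc).2.1, Finset.mem_insert_self _ _⟩
    · rcases Finset.mem_insert.1 hv with rfl | hv
      · exact ⟨d, hd, (mem_delta.1 hdd).2.1, fun x hx hxs =>
          (Finset.mem_insert.1 hxs).resolve_right (hds x hx)⟩
      · obtain ⟨c, hc, hvc, hx⟩ := hsp.2 v hv (hslt v hv)
        refine ⟨c, mem_fixed_succ.2 (Or.inl hc), hvc, fun x hxc hxs => ?_⟩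
        refine hx x hxc ((Finset.mem_insert.1 hxs).resolve_left fun h => ?_)
        exact ((mem_fixed.1 hc).2 x hxc).ne (congrArg Fin.val h)
  obtain ⟨u, hu⟩ := exists_isCompletion φ (k := i.val + 1) hmn (insert i s)
  have hult : ∀ x, x < i → (x ∈ u ↔ x ∈ s) := fun x hx => by
    rw [hu.1 x (Nat.lt_succ_of_lt hx)]
    simp [hx.ne]
  have hiu : i ∈ u := (hu.1 i (Nat.lt_succ_self _)).2 (Finset.mem_insert_self _ _)
  have hus : u.filter (· < i) = s := by
    ext x
    rw [Finset.mem_filter]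
    exact ⟨fun h => (hult x h.2).1 h.1, fun h => ⟨(hult x (hslt x h)).2 h, hslt x h⟩⟩
  have hunion : s ∪ t.filter (· < i) \ s = t.filter (· < i) := Finset.union_sdiff_of_subset hst
  have hmem : ∀ x, x.val < i.val + 1 → (x ∈ t.filter (· < i) ↔ x ∈ t) := fun x hx => by
    rw [Finset.mem_filter]
    refine ⟨And.left, fun h => ⟨h, lt_of_le_of_ne (Nat.lt_succ_iff.1 hx) fun e => ?_⟩⟩
    exact hit (e ▸ h)
  -- The witness in `ρ_{(u,i)}` is what was discarded in passing from `t` to `s`.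
  refine ⟨u, minimal_iff_prefixMin.2 (hu.prefixMin hsi hmn le_rfl), i, hiu,
    t.filter (· < i) \ s, ?_, ?_, ?_, ?_⟩
  · rw [mem_rho, minimal_isTransversal_iff, isTransversal_residual_iff]
    refine ⟨fun c hc hcu => ?_, fun v hv => ?_⟩
    · obtain ⟨x, hxc, hxt⟩ := hp.1 c (mem_fixed_succ.2 (Or.inr hc))
      have hxi : x < i := ((mem_delta.1 hc).2.2 x hxc).lt_of_ne fun h => hit (h ▸ hxt)
      exact ⟨x, hxc, hxi, Finset.mem_sdiff.2 ⟨Finset.mem_filter.2 ⟨hxt, hxi⟩, fun h =>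
        hcu x hxc hxi ((hult x hxi).2 h)⟩⟩
    · obtain ⟨hv1, hvs⟩ := Finset.mem_sdiff.1 hv
      obtain ⟨hvt, hvi⟩ := Finset.mem_filter.1 hv1
      obtain ⟨c, hc, hvc, hx⟩ := hp.2 v hvt (Nat.lt_succ_of_lt hvi)
      -- A private clause of a discarded variable misses `s`, hence lies in `Δ^i` and survives in
      -- `Δ^i[u]`.
      have hcs : ∀ x ∈ c, x ∉ s := fun x hx' hxs => by
        rw [hx x hx' (hst' hxs)] at hxs
        exact hvs hxs
      have hcd : c ∈ delta φ i := (mem_fixed_succ.1 hc).resolve_left fun hcf =>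
        let ⟨x, hx, hxs⟩ := hs.1 c hcf
        hcs x hx hxs
      refine ⟨c.erase i, ?_, Finset.mem_erase.2 ⟨hvi.ne, hvc⟩, fun x hxc hxr => ?_⟩
      · rw [residual, hus]
        refine Finset.mem_filter.2 ⟨Finset.mem_image_of_mem _ hcd, ?_⟩
        exact Finset.disjoint_left.2 fun x hxc => hcs x (Finset.mem_of_mem_erase hxc)
      · exact hx x (Finset.mem_of_mem_erase hxc)
          (Finset.mem_filter.1 (Finset.mem_sdiff.1 hxr).1).1
  · exact residual_nonempty_iff.2 ⟨d, hdd, fun x hx hxi hxu => hds x hx ((hult x hxi).1 hxu)⟩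
  · rw [hus, hunion]
    exact (minimal_fixed_iff_prefixMin (m := i.val + 1) fun j hj =>
      Nat.lt_succ_of_lt (Finset.mem_filter.1 hj).2).2 (hp.congr hmem)
  · rw [hus, hunion]
    exact ⟨fun j hj => (hmem j hj).symm, hcompt.2⟩

/-- Join `r` to the part of `t` before `x_i` and to all variables after `x_i`: this hits `φ`. A
minimal transversal `u` inside it must, by minimality of `r`, contain all of `r`, so `r` is
recovered from `u` as its part before `x_i` outside `t`. -/
theorem card_rho_le {φ : Finset (Finset (Fin n))} {t : Finset (Fin n)} (ht : IsTransversal φ t)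
    (i : Fin n) : (rho φ t i).card ≤ (primeImplicants (cnfFun φ)).card := by
  have key : ∀ r ∈ rho φ t i, ∃ u ∈ primeImplicants (cnfFun φ),
      (u.filter (· < i)) \ t = r := by
    intro r hr
    have htr : IsTransversal φ (t.filter (· < i) ∪ r ∪ Finset.univ.filter (i < ·)) := by
      intro c hc
      by_cases h : ∃ x ∈ c, i < x
      · obtain ⟨x, hx, hix⟩ := h
        exact ⟨x, hx, by simp [hix]⟩
      push Not at h
      by_cases hic : i ∈ c
      · have hcd : c ∈ delta φ i := mem_delta.2 ⟨hc, hic, h⟩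
        by_cases hct : ∃ x ∈ c, x < i ∧ x ∈ t
        · obtain ⟨x, hx, hxi, hxt⟩ := hct
          exact ⟨x, hx, by simp [hxi, hxt]⟩
        · push Not at hct
          obtain ⟨x, hx, -, hxr⟩ := isTransversal_residual_iff.1 (mem_rho.1 hr).1 c hcd hct
          exact ⟨x, hx, by simp [hxr]⟩
      · obtain ⟨x, hx, hxt⟩ := ht c hc
        have hxi : x < i := (h x hx).lt_of_ne fun e => hic (e ▸ hx)
        exact ⟨x, hx, by simp [hxi, hxt]⟩
    obtain ⟨u, hu, hmin⟩ := htr.exists_minimal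
    have hu' : ∀ x ∈ u, (x ∈ t ∧ x < i ∨ x ∈ r) ∨ i < x := fun x hx => by
      simpa only [Finset.mem_union, Finset.mem_filter, Finset.mem_univ, true_and] using hu hx
    refine ⟨u, mem_primeImplicants_cnfFun.2 hmin, ?_⟩
    have hsub : u.filter (· < i) \ t ⊆ r := by
      intro x hx
      obtain ⟨hx, hxt⟩ := Finset.mem_sdiff.1 hx
      obtain ⟨hxu, hxi⟩ := Finset.mem_filter.1 hx
      exact ((hu' x hxu).resolve_right hxi.not_gt).resolve_left fun h => hxt h.1
    refine hsub.antisymm ((mem_rho.1 hr).2 (isTransversal_residual_iff.2 fun c hc hct => ?_) hsub)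
    obtain ⟨x, hxc, hxu⟩ := hmin.1 c (mem_delta.1 hc).1
    -- The enlarged term omits `x_i` itself, so `u` hits clauses of `Δ^i` strictly before `x_i`.
    have hxi : x < i := by
      refine ((mem_delta.1 hc).2.2 x hxc).lt_of_ne ?_
      rintro rfl
      rcases hu' x hxu with (h | h) | h
      · exact h.2.false
      · exact (lt_and_notMem_of_mem_rho hr h).1.false
      · exact h.false
    exact ⟨x, hxc, hxi, Finset.mem_sdiff.2 ⟨Finset.mem_filter.2 ⟨hxu, hxi⟩, hct x hxc hxi⟩⟩
  choose! g hg using key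
  refine Finset.card_le_card_of_injOn g (fun r hr => (hg r hr).1) fun r hr s hs h => ?_
  rw [← (hg r hr).2, ← (hg s hs).2, h]

/-! ### Timed computations -/

@[simp] theorem Timed.val_pure {α : Type} (a : α) : (pure a : Timed α).val = a := rfl

@[simp] theorem Timed.time_pure {α : Type} (a : α) : (pure a : Timed α).time = 0 := rfl

@[simp] theorem Timed.val_bind {α β : Type} (x : Timed α) (g : α → Timed β) :
    (x >>= g).val = (g x.val).val := rfl

@[simp] theorem Timed.time_bind {α β : Type} (x : Timed α) (g : α → Timed β) :
    (x >>= g).time = x.time + (g x.val).time := rfl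

@[simp] theorem time_charge (k : ℕ) : (charge k).time = k := rfl

@[simp] theorem Arr.val_new {α : Type} (a : α) : (Arr.new n a).val = fun _ => a := rfl

@[simp] theorem Arr.time_new {α : Type} (a : α) : (Arr.new n a).time = n + 1 := rfl

@[simp] theorem Arr.val_get {α : Type} (A : Arr n α) (j : Fin n) : (A.get j).val = A j := rfl

@[simp] theorem Arr.time_get {α : Type} (A : Arr n α) (j : Fin n) : (A.get j).time = 1 := rfl

@[simp] theorem Arr.val_set {α : Type} (A : Arr n α) (j : Fin n) (a : α) :
    (A.set j a).val = Function.update A j a := rfl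

@[simp] theorem Arr.time_set {α : Type} (A : Arr n α) (j : Fin n) (a : α) :
    (A.set j a).time = 1 := rfl

theorem loop_val {α β : Type} (g : β → α → Timed β) (b : β) (l : List α) :
    (loop g b l).val = l.foldl (fun b a => (g b a).val) b := by
  induction l generalizing b with
  | nil => rfl
  | cons a l ih => simp [loop, ih]

/-- The cost bound `τ` may depend on the list element but not on the loop state; the extra units are
one per pass and one for the end of the list. -/
theorem loop_time_le {α β : Type} (g : β → α → Timed β) (b : β) (l : List α) (τ : α → ℕ)
    (hτ : ∀ b, ∀ a ∈ l, (g b a).time ≤ τ a) :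
    (loop g b l).time ≤ 1 + (l.map (fun a => 1 + τ a)).sum := by
  induction l generalizing b with
  | nil => simp [loop]
  | cons a l ih =>
    have h1 := hτ b a (by simp)
    have h2 := ih (g b a).val fun b a ha => hτ b a (List.mem_cons_of_mem _ ha)
    simp only [loop, Timed.time_bind, time_charge, List.map_cons, List.sum_cons]
    omega

theorem foldl_finRange_induction {β : Type} (g : β → Fin n → β) (P : ℕ → β → Prop) (b : β)
    (h0 : P 0 b) (hstep : ∀ (i : Fin n) b, P i.val b → P (i.val + 1) (g b i)) :
    P n ((List.finRange n).foldl g b) := by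
  have : ∀ m, m ≤ n → P m (((List.finRange n).take m).foldl g b) := by
    intro m
    induction m with
    | zero => intro _; simpa using h0
    | succ m ih =>
      intro hm
      have hl : m < (List.finRange n).length := by simpa using hm
      rw [List.take_succ_eq_append_getElem hl, List.foldl_append]
      simpa using hstep ⟨m, hm⟩ _ (ih (by omega))
  have h := this n le_rfl
  rwa [List.take_of_length_le (by simp)] at h

/-! ### The queue -/

/-- The tree contains the term with characteristic vector `A`. -/
def Tree.Mem (A : Arr n Bool) : List (Fin n) → Tree → Prop
  | [], .leaf => True
  | j :: js, .node l r => if A j then Tree.Mem A js l else Tree.Mem A js r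
  | _, _ => False

/-- All leaves have the right depth, and no node has two empty sons. -/
def Tree.WF : List (Fin n) → Tree → Prop
  | _, .empty => True
  | [], .leaf => True
  | _ :: js, .node l r => Tree.WF js l ∧ Tree.WF js r ∧ ¬ (l = .empty ∧ r = .empty)
  | _, _ => False

@[simp] theorem Tree.not_mem_empty (A : Arr n Bool) (js : List (Fin n)) :
    ¬ Tree.Mem A js .empty := by
  cases js <;> simp [Tree.Mem]

@[simp] theorem Tree.wf_empty (js : List (Fin n)) : Tree.WF js .empty := by
  cases js <;> simp [Tree.WF]

theorem Tree.insert_ne_empty (A : Arr n Bool) (js : List (Fin n)) (Q : Tree) :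
    (Tree.insert A js Q).val ≠ .empty := by
  cases js with
  | nil => simp [Tree.insert]
  | cons j js => cases Q <;> by_cases h : A j <;> simp [Tree.insert, h]

theorem Tree.wf_insert (A : Arr n Bool) (js : List (Fin n)) (Q : Tree) (hQ : Tree.WF js Q) :
    Tree.WF js (Tree.insert A js Q).val := by
  induction js generalizing Q with
  | nil => simp [Tree.insert, Tree.WF]
  | cons j js ih =>
    have hne := Tree.insert_ne_empty A js
    cases Q with
    | empty =>
      by_cases h : A j <;> simp [Tree.insert, h, Tree.WF, hne, ih]
    | leaf => simp [Tree.WF] at hQ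
    | node l r =>
      obtain ⟨hl, hr, -⟩ := hQ
      by_cases h : A j <;> simp [Tree.insert, h, Tree.WF, hne, ih, hl, hr]

theorem Tree.mem_insert (A X : Arr n Bool) (js : List (Fin n)) (Q : Tree) (hQ : Tree.WF js Q) :
    Tree.Mem X js (Tree.insert A js Q).val ↔ Tree.Mem X js Q ∨ ∀ j ∈ js, X j = A j := by
  induction js generalizing Q with
  | nil => simp [Tree.insert, Tree.Mem]
  | cons j js ih =>
    cases Q with
    | empty =>
      have := ih .empty (by simp)
      by_cases h : A j <;> by_cases hX : X j <;> simp [Tree.insert, h, Tree.Mem, hX, this]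
    | leaf => simp [Tree.WF] at hQ
    | node l r =>
      obtain ⟨hl, hr, -⟩ := hQ
      by_cases h : A j <;> by_cases hX : X j <;>
        simp [Tree.insert, h, Tree.Mem, hX, ih _ hl, ih _ hr]

theorem Tree.insert_time_le (A : Arr n Bool) (js : List (Fin n)) (Q : Tree) :
    (Tree.insert A js Q).time ≤ 2 * js.length + 1 := by
  induction js generalizing Q with
  | nil => simp [Tree.insert]
  | cons j js ih =>
    cases Q with
    | empty =>
      have := ih .empty
      by_cases h : A j <;> simp [Tree.insert, h] <;> omega
    | leaf =>
      have := ih .empty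
      by_cases h : A j <;> simp [Tree.insert, h] <;> omega
    | node l r =>
      have := ih l
      have := ih r
      by_cases h : A j <;> simp [Tree.insert, h] <;> omega

theorem Tree.popMin_time_le (js : List (Fin n)) (Q : Tree) (A : Arr n Bool) :
    (Tree.popMin js Q A).time ≤ 2 * js.length + 1 := by
  induction js generalizing Q A with
  | nil => simp [Tree.popMin]
  | cons j js ih =>
    cases Q with
    | empty => simp [Tree.popMin]
    | leaf => simp [Tree.popMin]
    | node l r =>
      cases r with
      | empty =>
        have := ih l (Function.update A j true)
        simp [Tree.popMin]
        omega
      | leaf =>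
        have := ih .leaf A
        simp [Tree.popMin]
        omega
      | node r₁ r₂ =>
        have := ih (.node r₁ r₂) A
        simp [Tree.popMin]
        omega

/-- The term `A` is smaller than `X`, as far as the listed variables are concerned. -/
def LexLt (A X : Arr n Bool) : List (Fin n) → Prop
  | [] => False
  | j :: js => (A j = false ∧ X j = true) ∨ (A j = X j ∧ LexLt A X js)

theorem Tree.mk_of_ne {l r : Tree} (h : ¬ (l = .empty ∧ r = .empty)) : Tree.mk l r = .node l r := by
  cases l <;> cases r <;> simp_all [Tree.mk]

theorem Tree.wf_mk {j : Fin n} {js : List (Fin n)} {l r : Tree} (hl : Tree.WF js l)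
    (hr : Tree.WF js r) : Tree.WF (j :: js) (Tree.mk l r) := by
  by_cases h : l = .empty ∧ r = .empty
  · obtain ⟨rfl, rfl⟩ := h
    simp [Tree.mk]
  · rw [Tree.mk_of_ne h]
    exact ⟨hl, hr, h⟩

theorem Tree.mem_mk {X : Arr n Bool} {j : Fin n} {js : List (Fin n)} {l r : Tree} :
    Tree.Mem X (j :: js) (Tree.mk l r) ↔ if X j then Tree.Mem X js l else Tree.Mem X js r := by
  by_cases h : l = .empty ∧ r = .empty
  · obtain ⟨rfl, rfl⟩ := h
    simp [Tree.mk]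
  · rw [Tree.mk_of_ne h]
    rfl

/-- What `popMin` does: the output is the smallest term, and it is removed. -/
structure Tree.PopMinSpec (js : List (Fin n)) (Q : Tree) (A T : Arr n Bool) (Q' : Tree) : Prop where
  wf : Tree.WF js Q'
  agree : ∀ j, j ∉ js → T j = A j
  mem : Tree.Mem T js Q
  mem_iff : ∀ X, Tree.Mem X js Q' ↔ Tree.Mem X js Q ∧ ∃ j ∈ js, X j ≠ T j
  le : ∀ X, Tree.Mem X js Q → (∀ j ∈ js, X j = T j) ∨ LexLt T X js

/-- Terms without `x_j` precede those with it, so the minimum is sought on the right whenever the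
right son is nonempty. -/
theorem Tree.PopMinSpec.right {j : Fin n} {js : List (Fin n)} {l r : Tree} {A T : Arr n Bool}
    {r' : Tree} (hj : j ∉ js) (hA : A j = false) (hl : Tree.WF js l)
    (h : Tree.PopMinSpec js r A T r') :
    Tree.PopMinSpec (j :: js) (.node l r) A T (Tree.mk l r') := by
  have hTj : T j = false := (h.agree j hj).trans hA
  refine ⟨Tree.wf_mk hl h.wf, fun k hk => h.agree k fun hk' => hk (List.mem_cons_of_mem _ hk'),
    ?_, fun X => ?_, fun X hX => ?_⟩
  · simpa [Tree.Mem, hTj] using h.mem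
  · rw [Tree.mem_mk]
    by_cases hX : X j <;> simp [Tree.Mem, hX, hTj, h.mem_iff]
  · by_cases hXj : X j
    · exact Or.inr (Or.inl ⟨hTj, hXj⟩)
    · have hXr : Tree.Mem X js r := by simpa [Tree.Mem, hXj] using hX
      have hXj : X j = T j := by simp [hXj, hTj]
      rcases h.le X hXr with h | h
      · exact Or.inl (List.forall_mem_cons.2 ⟨hXj, h⟩)
      · exact Or.inr (Or.inr ⟨hXj.symm, h⟩)

theorem Tree.PopMinSpec.left {j : Fin n} {js : List (Fin n)} {l : Tree} {A T : Arr n Bool}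
    {l' : Tree} (hj : j ∉ js) (h : Tree.PopMinSpec js l (Function.update A j true) T l') :
    Tree.PopMinSpec (j :: js) (.node l .empty) A T (Tree.mk l' .empty) := by
  have hTj : T j = true := by simpa using h.agree j hj
  refine ⟨Tree.wf_mk h.wf (by simp), fun k hk => ?_, ?_, fun X => ?_, fun X hX => ?_⟩
  · rw [List.mem_cons, not_or] at hk
    simpa [hk.1] using h.agree k hk.2
  · simpa [Tree.Mem, hTj] using h.mem
  · rw [Tree.mem_mk]
    by_cases hX : X j <;> simp [Tree.Mem, hX, hTj, h.mem_iff]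
  · by_cases hXj : X j
    · have hXl : Tree.Mem X js l := by simpa [Tree.Mem, hXj] using hX
      have hXj : X j = T j := by simp [hXj, hTj]
      rcases h.le X hXl with h | h
      · exact Or.inl (List.forall_mem_cons.2 ⟨hXj, h⟩)
      · exact Or.inr (Or.inr ⟨hXj.symm, h⟩)
    · simp [Tree.Mem, hXj] at hX

theorem Tree.popMin_spec (js : List (Fin n)) (hjs : js.Nodup) (Q : Tree) (hQ : Tree.WF js Q)
    (hne : Q ≠ .empty) (A : Arr n Bool) (hA : ∀ j ∈ js, A j = false) :
    Tree.PopMinSpec js Q A (Tree.popMin js Q A).val.1 (Tree.popMin js Q A).val.2 := by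
  induction js generalizing Q A with
  | nil =>
    cases Q with
    | empty => exact absurd rfl hne
    | leaf => exact ⟨by simp [Tree.popMin], by simp [Tree.popMin], by simp [Tree.Mem],
        by simp [Tree.popMin], by simp⟩
    | node l r => simp [Tree.WF] at hQ
  | cons j js ih =>
    rw [List.nodup_cons] at hjs
    cases Q with
    | empty => exact absurd rfl hne
    | leaf => simp [Tree.WF] at hQ
    | node l r =>
      obtain ⟨hl, hr, hlr⟩ := hQ
      have hAj : A j = false := hA j (by simp)
      have hAjs : ∀ k ∈ js, A k = false := fun k hk => hA k (List.mem_cons_of_mem _ hk)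
      cases r with
      | empty =>
        refine Tree.PopMinSpec.left hjs.1 (ih hjs.2 l hl (fun h => hlr ⟨h, rfl⟩) _ fun k hk => ?_)
        have : k ≠ j := fun h => hjs.1 (h ▸ hk)
        simpa [this] using hAjs k hk
      | leaf => exact Tree.PopMinSpec.right hjs.1 hAj hl (ih hjs.2 _ hr (by simp) A hAjs)
      | node r₁ r₂ => exact Tree.PopMinSpec.right hjs.1 hAj hl (ih hjs.2 _ hr (by simp) A hAjs)

theorem mem_support {A : Arr n Bool} {j : Fin n} : j ∈ support A ↔ A j = true := by
  simp [support]

theorem support_injective : Function.Injective (support (n := n)) := by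
  intro A B h
  funext j
  rw [Bool.eq_iff_iff, ← mem_support, ← mem_support, h]

theorem LexLt.exists_first_difference {A X : Arr n Bool} {js : List (Fin n)} (h : LexLt A X js)
    (hjs : js.Pairwise (· < ·)) :
    ∃ j ∈ js, A j = false ∧ X j = true ∧ ∀ k ∈ js, k < j → A k = X k := by
  induction js with
  | nil => exact h.elim
  | cons j js ih =>
    rw [List.pairwise_cons] at hjs
    rcases h with ⟨hA, hX⟩ | ⟨hAX, h⟩
    · refine ⟨j, by simp, hA, hX, fun k hk hkj => ?_⟩
      rcases List.mem_cons.1 hk with rfl | hk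
      · exact absurd hkj (lt_irrefl _)
      · exact absurd hkj (hjs.1 k hk).not_gt
    · obtain ⟨i, hi, h1, h2, h3⟩ := ih h hjs.2
      refine ⟨i, List.mem_cons_of_mem _ hi, h1, h2, fun k hk hki => ?_⟩
      rcases List.mem_cons.1 hk with rfl | hk
      · exact hAX
      · exact h3 k hk hki

theorem LexLt.weight_lt {A X : Arr n Bool} (h : LexLt A X (List.finRange n)) :
    weight (support A) < weight (support X) := by
  obtain ⟨j, -, hA, hX, hlt⟩ := h.exists_first_difference (List.pairwise_lt_finRange n)
  refine weight_lt_of_first_difference (j := j) (by simp [mem_support, hA])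
    (by simp [mem_support, hX]) fun x hx => ?_
  rw [mem_support, mem_support, hlt x (List.mem_finRange x) hx]

/-! ### The subroutines of Algorithm Dualize -/

theorem Represents.mem {L : List (List (Fin n))} {φ : Finset (Finset (Fin n))}
    (h : Represents L φ) {c : List (Fin n)} (hc : c ∈ L) : c.toFinset ∈ φ := by
  rw [← h.2.2, List.mem_toFinset]
  exact List.mem_map_of_mem hc

theorem Represents.exists_mem {L : List (List (Fin n))} {φ : Finset (Finset (Fin n))}
    (h : Represents L φ) {d : Finset (Fin n)} (hd : d ∈ φ) : ∃ c ∈ L, c.toFinset = d := by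
  rwa [← h.2.2, List.mem_toFinset, List.mem_map] at hd

theorem Represents.length_eq_card {L : List (List (Fin n))} {φ : Finset (Finset (Fin n))}
    (h : Represents L φ) : L.length = φ.card := by
  rw [← h.2.2, List.toFinset_card_of_nodup h.1, List.length_map]

/-- The number of cells of a list of clauses. -/
def cells (L : List (List (Fin n))) : ℕ := (L.map fun c => 1 + c.length).sum

theorem sum_map_le_mul_cells (L : List (List (Fin n))) (g : List (Fin n) → ℕ) (k : ℕ)
    (h : ∀ c, g c ≤ k * (1 + c.length)) : (L.map g).sum ≤ k * cells L := by
  rw [cells, ← List.sum_map_mul_left]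
  exact List.sum_le_sum fun c _ => h c

/-- Without empty clauses, `1 + |c| ≤ 2|c|`. -/
theorem Represents.cells_le {L : List (List (Fin n))} {φ : Finset (Finset (Fin n))}
    (h : Represents L φ) (hne : ∅ ∉ φ) : cells L ≤ 2 * length φ := by
  have : length φ = (L.map fun c => c.length).sum := by
    rw [length, ← h.2.2, List.sum_toFinset _ h.1, List.map_map]
    congr 1
    exact List.map_congr_left fun c hc => List.toFinset_card_of_nodup (h.2.1 c hc)
  rw [this, cells, ← List.sum_map_mul_left]
  refine List.sum_le_sum fun c hc => ?_
  have : c.length ≠ 0 := fun h0 => by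
    have hc' := h.mem hc
    rw [List.length_eq_zero_iff.1 h0] at hc'
    exact hne (by simpa using hc')
  omega

/-! ### Sorting the clauses by their last variable -/

theorem lastVar_val_eq_some {c : List (Fin n)} {i : Fin n} :
    (lastVar c).val = some i ↔ i ∈ c ∧ ∀ j ∈ c, j ≤ i := by
  have key : ∀ (l : List (Fin n)) (k : Fin n), ∃ m,
      l.foldl (fun (m : Option (Fin n)) j => (match m with
        | none => return some j
        | some k => return some (if k < j then j else k) : Timed (Option (Fin n))).val) (some k)
        = some m ∧ (m = k ∨ m ∈ l) ∧ k ≤ m ∧ ∀ j ∈ l, j ≤ m := by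
    intro l
    induction l with
    | nil => intro k; simp
    | cons a l ih =>
      intro k
      obtain ⟨m, h1, h2, h3, h4⟩ := ih (if k < a then a else k)
      refine ⟨m, h1, ?_, ?_, ?_⟩
      · split_ifs at h2 <;> simp only [List.mem_cons] <;> tauto
      · split_ifs at h3 with h
        · exact h.le.trans h3
        · exact h3
      · refine List.forall_mem_cons.2 ⟨?_, h4⟩
        split_ifs at h3 with h
        · exact h3
        · exact (not_lt.1 h).trans h3
  rw [lastVar, loop_val]
  cases c with
  | nil => simp
  | cons a l =>
    obtain ⟨m, h1, h2, h3, h4⟩ := key l a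
    have hm : m ∈ a :: l ∧ ∀ j ∈ a :: l, j ≤ m :=
      ⟨List.mem_cons.2 h2, List.forall_mem_cons.2 ⟨h3, h4⟩⟩
    refine (iff_of_eq (congrArg (· = some i) h1)).trans ?_
    rw [Option.some_inj]
    constructor
    · rintro rfl
      exact hm
    · rintro ⟨hi, hle⟩
      exact le_antisymm (hle m hm.1) (hm.2 i hi)

theorem lastVar_time_le (c : List (Fin n)) : (lastVar c).time ≤ 1 + c.length := by
  refine (loop_time_le _ _ _ (fun _ => 0) ?_).trans (by simp)
  intro b a _
  cases b <;> simp

theorem buckets_val (L : List (List (Fin n))) (i : Fin n) :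
    (buckets L).val i = (L.filter fun c => (lastVar c).val = some i).reverse := by
  have key : ∀ (L : List (List (Fin n))) (B : Arr n (List (List (Fin n)))),
      (loop (fun B c => do
        match ← lastVar c with
        | none => return B
        | some i =>
            let l ← B.get i
            B.set i (c :: l)) B L).val i =
      (L.filter fun c => (lastVar c).val = some i).reverse ++ B i := by
    intro L
    induction L with
    | nil => intro B; simp [loop]
    | cons c L ih =>
      intro B
      simp only [loop, Timed.val_bind, ih]
      rcases h : (lastVar c).val with _ | j
      · simp [h]
      · by_cases hij : i = j
        · subst hij
          simp [h]
        · have : j ≠ i := fun e => hij e.symm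
          simp [h, hij, this]
  exact (key L fun _ => []).trans (List.append_nil _)

theorem buckets_time_le (L : List (List (Fin n))) :
    (buckets L).time ≤ n + 2 + 4 * cells L := by
  have h := loop_time_le (fun (B : Arr n (List (List (Fin n)))) c => do
        match ← lastVar c with
        | none => return B
        | some i =>
            let l ← B.get i
            B.set i (c :: l)) (fun _ => []) L (fun c => 3 + c.length) (by
    intro B c _
    have := lastVar_time_le c
    rcases h : (lastVar c).val with _ | j <;> simp [h] <;> omega)
  have h2 := sum_map_le_mul_cells L (fun c => 1 + (3 + c.length)) 4 fun c => by omega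
  refine (Nat.add_le_add_left h (n + 1)).trans ?_
  omega

theorem represents_buckets {L : List (List (Fin n))} {φ : Finset (Finset (Fin n))}
    (h : Represents L φ) (i : Fin n) : Represents ((buckets L).val i) (delta φ i) := by
  rw [buckets_val]
  refine ⟨?_, fun c hc => ?_, ?_⟩
  · rw [List.map_reverse, List.nodup_reverse]
    exact h.1.sublist (List.filter_sublist.map _)
  · exact h.2.1 c (List.mem_of_mem_filter (List.mem_reverse.1 hc))
  · ext d
    simp only [List.mem_toFinset, List.mem_map, List.mem_reverse, List.mem_filter,
      decide_eq_true_eq, lastVar_val_eq_some, mem_delta]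
    constructor
    · rintro ⟨c, ⟨hc, hi, hle⟩, rfl⟩
      exact ⟨h.mem hc, by simpa using hi, by simpa using hle⟩
    · rintro ⟨hd, hi, hle⟩
      obtain ⟨c, hc, rfl⟩ := h.exists_mem hd
      exact ⟨c, ⟨hc, by simpa using hi, by simpa using hle⟩, rfl⟩

/-- A clause has at most one last variable, so it is counted in at most one bucket. -/
theorem sum_cells_buckets_le (L : List (List (Fin n))) :
    ((List.finRange n).map fun i => cells ((buckets L).val i)).sum ≤ cells L := by
  have hB : ∀ i, cells ((buckets L).val i) =
      (L.map fun c => if (lastVar c).val = some i then 1 + c.length else 0).sum := by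
    intro i
    rw [buckets_val, cells, List.map_reverse, List.sum_reverse]
    induction L with
    | nil => rfl
    | cons c L ih => by_cases h : (lastVar c).val = some i <;> simp [h, ih]
  simp only [hB]
  clear hB
  rw [← Fin.sum_univ_def]
  induction L with
  | nil => simp
  | cons c L ih =>
    simp only [List.map_cons, List.sum_cons, Finset.sum_add_distrib, cells] at ih ⊢
    refine Nat.add_le_add ?_ ih
    rcases (lastVar c).val with _ | j
    · simp
    · simp

/-! ### The greedy completion and the residual CNF -/

theorem hits_val (A : Arr n Bool) (c : List (Fin n)) :
    (hits A c).val = true ↔ ∃ j ∈ c, A j = true := by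
  have key : ∀ (c : List (Fin n)) (h : Bool),
      c.foldl (fun h j => h || A j) h = true ↔ h = true ∨ ∃ j ∈ c, A j = true := by
    intro c
    induction c with
    | nil => simp
    | cons a c ih =>
      intro h
      simp [ih, or_assoc]
  rw [hits, loop_val]
  simpa using key c false

theorem hits_time_le (A : Arr n Bool) (c : List (Fin n)) :
    (hits A c).time ≤ 1 + 2 * c.length := by
  refine (loop_time_le _ _ _ (fun _ => 1) (by simp)).trans ?_
  simp
  omega

theorem needed_val (A : Arr n Bool) (l : List (List (Fin n))) :
    (loop (fun b c => do
        let h ← hits A c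
        return b || !h) false l).val = true ↔ ∃ c ∈ l, ∀ j ∈ c, A j = false := by
  have key : ∀ (l : List (List (Fin n))) (b : Bool),
      l.foldl (fun b c => b || !(hits A c).val) b = true ↔
        b = true ∨ ∃ c ∈ l, ∀ j ∈ c, A j = false := by
    intro l
    induction l with
    | nil => simp
    | cons c l ih =>
      intro b
      have hc : (hits A c).val = false ↔ ∀ j ∈ c, A j = false := by
        rw [← Bool.not_eq_true, hits_val]
        simp
      simp [ih, hc, or_assoc]
  rw [loop_val]
  simpa using key l false

theorem complete_val {φ : Finset (Finset (Fin n))} {B : Arr n (List (List (Fin n)))}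
    (hB : ∀ i, Represents (B i) (delta φ i)) (k : ℕ) (A : Arr n Bool)
    (hA : ∀ j : Fin n, k ≤ j.val → A j = false) :
    IsCompletion φ k (support A) (support (complete B k A).val) := by
  rw [complete, loop_val]
  have := foldl_finRange_induction (fun (A : Arr n Bool) (j : Fin n) => (do
    if k ≤ j.val then
      let l ← B.get j
      let needed ← loop (fun b c => do
        let h ← hits A c
        return b || !h) false l
      if needed then A.set j true else return A
    else return A : Timed (Arr n Bool)).val)
    -- Invariant after `m` variables: later entries and those below `k` are untouched, and the
    -- entries from `k` up to `m` obey the greedy rule.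
    (fun m A' => (∀ j : Fin n, m ≤ j.val → A' j = A j) ∧ (∀ j : Fin n, j.val < k → A' j = A j) ∧
      ∀ j : Fin n, j.val < m → k ≤ j.val →
        (A' j = true ↔ ∃ c ∈ delta φ j, ∀ x ∈ c, x < j → A' x = false)) A
    ⟨fun _ _ => rfl, fun _ _ => rfl, fun j hj => absurd hj (Nat.not_lt_zero _)⟩ ?_
  · refine ⟨fun j hj => by rw [mem_support, mem_support, this.2.1 j hj], fun j hj => ?_⟩
    rw [mem_support, this.2.2 j j.isLt hj]
    simp [mem_support]
  · rintro i A' ⟨h1, h2, h3⟩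
    by_cases hk : k ≤ i.val
    swap
    · simp only [hk, if_false, Timed.val_pure]
      refine ⟨fun j hj => h1 j (by omega), h2, fun j hj hkj => ?_⟩
      exact h3 j (by omega) hkj
    have hi : A' i = false := (h1 i le_rfl).trans (hA i hk)
    -- The program tests whole clauses, the greedy rule only the part before `x_i`; these agree
    -- because `x_i` is last in the clause and its entry is still false.
    have hneed : (loop (fun b c => do
        let h ← hits A' c
        return b || !h) false (B i)).val = true ↔
        ∃ c ∈ delta φ i, ∀ x ∈ c, x < i → A' x = false := by
      rw [needed_val]
      constructor
      · rintro ⟨c, hc, hx⟩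
        exact ⟨c.toFinset, (hB i).mem hc, fun x hxc _ => hx x (List.mem_toFinset.1 hxc)⟩
      · rintro ⟨d, hd, hx⟩
        obtain ⟨c, hc, rfl⟩ := (hB i).exists_mem hd
        refine ⟨c, hc, fun x hxc => ?_⟩
        have hxc' := List.mem_toFinset.2 hxc
        rcases ((mem_delta.1 hd).2.2 x hxc').lt_or_eq with h | h
        · exact hx x hxc' h
        · exact h ▸ hi
    have hval : (do
      if k ≤ i.val then
        let l ← B.get i
        let needed ← loop (fun b c => do
          let h ← hits A' c
          return b || !h) false l
        if needed then A'.set i true else return A'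
      else return A' : Timed (Arr n Bool)).val = Function.update A' i (loop (fun b c => do
        let h ← hits A' c
        return b || !h) false (B i)).val := by
      simp only [hk, if_true, Timed.val_bind, Arr.val_get]
      split_ifs with hb
      · rw [hb, Arr.val_set]
      · rw [Bool.not_eq_true] at hb
        rw [Timed.val_pure, hb, ← hi, Function.update_eq_self]
    rw [hval]
    have hne : ∀ j : Fin n, j.val < i.val → j ≠ i := fun j hj h => by simp [h] at hj
    refine ⟨fun j hj => ?_, fun j hj => ?_, fun j hj hkj => ?_⟩
    · have : j ≠ i := fun h => by simp [h] at hj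
      rw [Function.update_of_ne this]
      exact h1 j (by omega)
    · rw [Function.update_of_ne (hne j (by omega))]
      exact h2 j hj
    · have hlow : ∀ x : Fin n, x < j → ∀ b, Function.update A' i b x = A' x := fun x hx b =>
        Function.update_of_ne (hne x (by have : x.val < j.val := hx; omega)) _ _
      have hrew : (∃ c ∈ delta φ j, ∀ x ∈ c, x < j → Function.update A' i (loop (fun b c => do
        let h ← hits A' c
        return b || !h) false (B i)).val x = false) ↔
          ∃ c ∈ delta φ j, ∀ x ∈ c, x < j → A' x = false :=
        exists_congr fun c => and_congr_right fun _ => forall₂_congr fun x _ =>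
          forall_congr' fun hx => by rw [hlow x hx]
      rw [hrew]
      by_cases hji : j = i
      · subst hji
        rw [Function.update_self, hneed]
      · rw [Function.update_of_ne hji]
        exact h3 j (lt_of_le_of_ne (by omega) fun h => hji (Fin.ext h)) hkj

theorem complete_time_le (B : Arr n (List (List (Fin n)))) (k : ℕ) (A : Arr n Bool) :
    (complete B k A).time ≤ 1 + 4 * n + 2 * ((List.finRange n).map fun i => cells (B i)).sum := by
  rw [complete]
  refine (loop_time_le _ _ _ (fun i => 3 + 2 * cells (B i)) ?_).trans ?_
  · intro A j _
    have h := loop_time_le (fun b c => do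
        let h ← hits A c
        return b || !h) false (B j) (fun c => 1 + 2 * c.length)
      (by intro b c _; simpa using hits_time_le A c)
    have h2 := sum_map_le_mul_cells (B j) (fun c => 1 + (1 + 2 * c.length)) 2 fun c => by omega
    split_ifs
    · simp only [Timed.time_bind, Arr.time_get, Arr.val_get]
      split_ifs
      · simp only [Arr.time_set]
        omega
      · simp only [Timed.time_pure]
        omega
    · simp
  · simp only [List.sum_map_add, List.sum_map_mul_left, List.map_const', List.sum_replicate,
      List.length_finRange, smul_eq_mul]
    omega

theorem buildResidual_val {φ : Finset (Finset (Fin n))} {B : Arr n (List (List (Fin n)))}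
    (hB : ∀ i, Represents (B i) (delta φ i)) (A : Arr n Bool) (i : Fin n) :
    Represents (buildResidual B A i).val (residual φ i (support A)) := by
  have hin : ∀ (c : List (Fin n)) (p : Bool × List (Fin n)),
      ((loop (fun (p : Bool × List (Fin n)) j => do
      if j = i then return p
      else
        let b ← A.get j
        return (p.1 || b, j :: p.2)) p c).val.1 = true ↔ p.1 = true ∨ ∃ j ∈ c, j ≠ i ∧ A j = true) ∧
      (loop (fun (p : Bool × List (Fin n)) j => do
      if j = i then return p
      else
        let b ← A.get j
        return (p.1 || b, j :: p.2)) p c).val.2 = (c.filter (· ≠ i)).reverse ++ p.2 := by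
    intro c
    induction c with
    | nil => simp [loop]
    | cons j c ih =>
      intro p
      simp only [loop, Timed.val_bind]
      by_cases hj : j = i
      · simpa [hj] using ih p
      · simpa [hj, or_assoc] using ih (p.1 || A j, j :: p.2)
  let e : List (Fin n) → List (Fin n) := fun c => (c.filter (· ≠ i)).reverse
  have hout : ∀ (l Γ : List (List (Fin n))),
      (loop (fun (Γ : List (List (Fin n))) c => do
        let (h, c') ← loop (fun (p : Bool × List (Fin n)) j => do
          if j = i then return p
          else
            let b ← A.get j
            return (p.1 || b, j :: p.2)) (false, []) c
        if h then return Γ else return (c' :: Γ)) Γ l).val =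
      ((l.filter fun c => ∀ j ∈ c, j ≠ i → A j = false).map e).reverse ++ Γ := by
    intro l
    induction l with
    | nil => simp [loop]
    | cons c l ih =>
      intro Γ
      obtain ⟨h1, h2⟩ := hin c (false, [])
      simp only [loop, Timed.val_bind, ih]
      rw [List.append_nil] at h2
      by_cases hc : ∃ j ∈ c, j ≠ i ∧ A j = true
      · have hf : ¬ ∀ j ∈ c, j ≠ i → A j = false := by
          obtain ⟨j, hj, hji, hA⟩ := hc
          exact fun h => by simp [h j hj hji] at hA
        rw [if_pos (h1.2 (Or.inr hc)), List.filter_cons_of_neg (by simpa using hf)]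
        rfl
      · have hf : ∀ j ∈ c, j ≠ i → A j = false := by
          intro j hj hji
          by_contra hA
          exact hc ⟨j, hj, hji, by simpa using hA⟩
        have hcond := mt h1.1 (by simpa using hc)
        rw [if_neg hcond, List.filter_cons_of_pos (by simpa using hf), Timed.val_pure, h2]
        simp [e]
  have hval : (buildResidual B A i).val =
      (((B i).filter fun c => ∀ j ∈ c, j ≠ i → A j = false).map e).reverse := by
    rw [buildResidual, Timed.val_bind, Arr.val_get, hout, List.append_nil]
  have he : ∀ c, (e c).toFinset = c.toFinset.erase i := by
    intro c
    ext x
    simp [e, and_comm]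
  -- The program tests all variables except `x_i`; since `x_i` is the last one, these are the
  -- variables before it.
  have hdisj : ∀ c ∈ B i, (∀ j ∈ c, j ≠ i → A j = false) ↔
      Disjoint (c.toFinset.erase i) ((support A).filter (· < i)) := by
    intro c hc
    have hle := (mem_delta.1 ((hB i).mem hc)).2.2
    rw [Finset.disjoint_left]
    simp only [Finset.mem_erase, List.mem_toFinset, Finset.mem_filter, mem_support, and_imp] at hle ⊢
    constructor
    · intro h x hxi hxc
      simp [h x hxc hxi]
    · intro h x hxc hxi
      by_contra hA
      exact h hxi hxc ⟨by simpa using hA, (hle x hxc).lt_of_ne hxi⟩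
  rw [hval]
  refine ⟨?_, fun c hc => ?_, ?_⟩
  · rw [List.map_reverse, List.nodup_reverse, List.map_map]
    have hnd : (((B i).filter fun c => ∀ j ∈ c, j ≠ i → A j = false).map List.toFinset).Nodup :=
      (hB i).1.sublist (List.filter_sublist.map _)
    have : (((B i).filter fun c => ∀ j ∈ c, j ≠ i → A j = false).map (List.toFinset ∘ e)) =
        (((B i).filter fun c => ∀ j ∈ c, j ≠ i → A j = false).map List.toFinset).map
          (fun d => d.erase i) := by
      rw [List.map_map]
      exact List.map_congr_left fun c _ => he c
    rw [this]
    -- Erasing `i` creates no repetitions, since every clause in the bucket contains `i`.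
    refine hnd.map_on fun d hd d' hd' h => ?_
    have hi : ∀ d ∈ ((B i).filter fun c => ∀ j ∈ c, j ≠ i → A j = false).map List.toFinset,
        i ∈ d := by
      intro d hd
      obtain ⟨c, hc, rfl⟩ := List.mem_map.1 hd
      exact (mem_delta.1 ((hB i).mem (List.mem_of_mem_filter hc))).2.1
    rw [← Finset.insert_erase (hi d hd), h, Finset.insert_erase (hi d' hd')]
  · obtain ⟨d, hd, rfl⟩ := List.mem_map.1 (List.mem_reverse.1 hc)
    exact List.nodup_reverse.2 (((hB i).2.1 d (List.mem_of_mem_filter hd)).filter _)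
  · ext d
    simp only [List.mem_toFinset, List.mem_map, List.mem_reverse, List.mem_filter,
      decide_eq_true_eq, residual, Finset.mem_filter, Finset.mem_image]
    constructor
    · rintro ⟨_, ⟨c, ⟨hc, hA⟩, rfl⟩, rfl⟩
      rw [he]
      exact ⟨⟨_, (hB i).mem hc, rfl⟩, (hdisj c hc).1 hA⟩
    · rintro ⟨⟨d, hd, rfl⟩, hdj⟩
      obtain ⟨c, hc, rfl⟩ := (hB i).exists_mem hd
      exact ⟨_, ⟨c, ⟨hc, (hdisj c hc).2 hdj⟩, rfl⟩, he c⟩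

theorem buildResidual_time_le (B : Arr n (List (List (Fin n)))) (A : Arr n Bool) (i : Fin n) :
    (buildResidual B A i).time ≤ 2 + 2 * cells (B i) := by
  have h := loop_time_le (fun (Γ : List (List (Fin n))) c => do
        let (h, c') ← loop (fun (p : Bool × List (Fin n)) j => do
          if j = i then return p
          else
            let b ← A.get j
            return (p.1 || b, j :: p.2)) (false, []) c
        if h then return Γ else return (c' :: Γ)) [] (B i) (fun c => 1 + 2 * c.length) (by
    intro Γ c _
    have h := loop_time_le (fun (p : Bool × List (Fin n)) j => do
          if j = i then return p
          else
            let b ← A.get j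
            return (p.1 || b, j :: p.2)) (false, []) c (fun _ => 1) (by
      intro p j _
      by_cases hj : j = i <;> simp [hj])
    rw [List.map_const', List.sum_replicate, smul_eq_mul] at h
    simp only [Timed.time_bind]
    split_ifs <;> simp only [Timed.time_pure] <;> omega)
  have h2 := sum_map_le_mul_cells (B i) (fun c => 1 + (1 + 2 * c.length)) 2 fun c => by omega
  refine (Nat.add_le_add_left h 1).trans ?_
  omega

theorem support_merge_val (A : Arr n Bool) (i : Fin n) (r : List (Fin n)) :
    support (merge A i r).val = (support A).filter (· < i) ∪ r.toFinset := by
  have h1 := foldl_finRange_induction (fun (S : Arr n Bool) (j : Fin n) => (do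
    if j < i then
      let b ← A.get j
      S.set j b
    else return S : Timed (Arr n Bool)).val)
    (fun m S => ∀ j : Fin n, S j = true ↔ j.val < m ∧ j < i ∧ A j = true) (fun _ => false)
    (by simp) (by
      intro k S hS j
      by_cases hk : k < i
      · simp only [hk, if_true, Timed.val_bind, Arr.val_get, Arr.val_set]
        by_cases hjk : j = k
        · subst hjk
          simp [hk]
        · rw [Function.update_of_ne hjk, hS j]
          have : j.val ≠ k.val := fun h => hjk (Fin.ext h)
          have : j.val < k.val ↔ j.val < k.val + 1 := by omega
          rw [this]
      · simp only [hk, if_false, Timed.val_pure, hS j]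
        constructor
        · rintro ⟨h1, h2⟩
          exact ⟨by omega, h2⟩
        · rintro ⟨h1, h2, h3⟩
          have : j.val < i.val := h2
          have : ¬ k.val < i.val := hk
          exact ⟨by omega, h2, h3⟩)
  have h2 : ∀ (r : List (Fin n)) (S : Arr n Bool) (j : Fin n),
      (loop (fun (S : Arr n Bool) j => S.set j true) S r).val j = true ↔ S j = true ∨ j ∈ r := by
    intro r
    induction r with
    | nil => simp [loop]
    | cons k r ih =>
      intro S j
      simp only [loop, Timed.val_bind, ih, Arr.val_set]
      by_cases hjk : j = k
      · subst hjk
        simp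
      · simp [hjk]
  ext j
  simp only [merge, Timed.val_bind, Arr.val_new, mem_support, h2, Finset.mem_union,
    Finset.mem_filter, List.mem_toFinset]
  rw [loop_val, h1]
  simp [and_comm]

theorem merge_time_le (A : Arr n Bool) (i : Fin n) (r : List (Fin n)) :
    (merge A i r).time ≤ 3 + 4 * n + 2 * r.length := by
  have h1 := loop_time_le (fun (S : Arr n Bool) (j : Fin n) => do
    if j < i then
      let b ← A.get j
      S.set j b
    else return S) (fun _ => false) (List.finRange n) (fun _ => 2) (by
      intro S j _
      split_ifs <;> simp)
  have h2 := fun S => loop_time_le (fun (S : Arr n Bool) j => S.set j true) S r (fun _ => 1) (by simp)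
  simp only [List.map_const', List.sum_replicate, smul_eq_mul, List.length_finRange] at h1 h2
  simp only [merge, Timed.time_bind, Arr.val_new, Arr.time_new]
  have h3 := h2 (loop (fun (S : Arr n Bool) (j : Fin n) => do
    if j < i then
      let b ← A.get j
      S.set j b
    else return S) (fun _ => false) (List.finRange n)).val
  omega

/-- The body of the loop of `isPrime` over the clauses. -/
def markClause (S : Arr n Bool) (s : Bool × Arr n Bool) (c : List (Fin n)) :
    Timed (Bool × Arr n Bool) := do
  let found ← loop (fun (h : List (Fin n)) j => do
    if ← S.get j then return j :: h else return h) [] c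
  match found with
  | [] => return (false, s.2)
  | [j] =>
      let P' ← s.2.set j true
      return (s.1, P')
  | _ => return s

/-- The body of the outer loop of `isPrime`. -/
def markBucket (B : Arr n (List (List (Fin n)))) (S : Arr n Bool) (i : Fin n)
    (s : Bool × Arr n Bool) (k : Fin n) : Timed (Bool × Arr n Bool) := do
  if k ≤ i then
    let l ← B.get k
    loop (markClause S) s l
  else return s

theorem isPrime_eq (B : Arr n (List (List (Fin n)))) (S : Arr n Bool) (i : Fin n) :
    isPrime B S i = (do
      let P ← Arr.new n false
      let s ← loop (markBucket B S i) (true, P) (List.finRange n)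
      loop (fun ok j => do
        let b ← S.get j
        let p ← s.2.get j
        return ok && (!b || p)) s.1 (List.finRange n)) := rfl

theorem found_val (S : Arr n Bool) (c h : List (Fin n)) :
    (loop (fun (h : List (Fin n)) j => do
      if ← S.get j then return j :: h else return h) h c).val = (c.filter S).reverse ++ h := by
  induction c generalizing h with
  | nil => simp [loop]
  | cons j c ih =>
    simp only [loop, Timed.val_bind, ih]
    by_cases hj : S j = true <;> simp [hj]

theorem found_time_le (S : Arr n Bool) (c : List (Fin n)) :
    (loop (fun (h : List (Fin n)) j => do
      if ← S.get j then return j :: h else return h) [] c).time ≤ 1 + 2 * c.length := by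
  refine (loop_time_le _ _ _ (fun _ => 1) ?_).trans ?_
  · intro h j _
    by_cases hj : S j = true <;> simp [hj]
  · simp
    omega

theorem markClause_val (S : Arr n Bool) (s : Bool × Arr n Bool) (c : List (Fin n)) :
    ((markClause S s c).val.1 = true ↔ s.1 = true ∧ c.filter S ≠ []) ∧
      ∀ j, (markClause S s c).val.2 j = true ↔ s.2 j = true ∨ c.filter S = [j] := by
  have h0 := found_val S c []
  rw [List.append_nil] at h0
  rw [markClause, Timed.val_bind, h0]
  rcases h : c.filter S with _ | ⟨a, _ | ⟨b, l⟩⟩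
  · simp
  · refine ⟨by simp, fun j => ?_⟩
    by_cases hj : j = a
    · subst hj
      simp
    · have : a ≠ j := fun e => hj e.symm
      simp [hj, this]
  · rcases h' : (a :: b :: l).reverse with _ | ⟨a', _ | ⟨b', l'⟩⟩
    · simp at h'
    · have := congrArg List.length h'
      simp at this
    · simp

theorem markClause_time_le (S : Arr n Bool) (s : Bool × Arr n Bool) (c : List (Fin n)) :
    (markClause S s c).time ≤ 2 + 2 * c.length := by
  have h := found_time_le S c
  rw [markClause, Timed.time_bind]
  split <;> simp <;> omega

theorem loop_markClause_val (S : Arr n Bool) (s : Bool × Arr n Bool) (l : List (List (Fin n))) :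
    ((loop (markClause S) s l).val.1 = true ↔ s.1 = true ∧ ∀ c ∈ l, c.filter S ≠ []) ∧
      ∀ j, (loop (markClause S) s l).val.2 j = true ↔
        s.2 j = true ∨ ∃ c ∈ l, c.filter S = [j] := by
  induction l generalizing s with
  | nil => simp [loop]
  | cons c l ih =>
    obtain ⟨h1, h2⟩ := markClause_val S s c
    obtain ⟨h3, h4⟩ := ih (markClause S s c).val
    simp only [loop, Timed.val_bind, h3, h4, h1, h2, List.mem_cons, forall_eq_or_imp,
      exists_eq_or_imp,
      and_assoc, or_assoc]
    exact ⟨trivial, fun _ => trivial⟩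

theorem loop_markBucket_val (B : Arr n (List (List (Fin n)))) (S : Arr n Bool) (i : Fin n)
    (s : Bool × Arr n Bool) (js : List (Fin n)) :
    ((loop (markBucket B S i) s js).val.1 = true ↔
        s.1 = true ∧ ∀ k ∈ js, k ≤ i → ∀ c ∈ B k, c.filter S ≠ []) ∧
      ∀ j, (loop (markBucket B S i) s js).val.2 j = true ↔
        s.2 j = true ∨ ∃ k ∈ js, k ≤ i ∧ ∃ c ∈ B k, c.filter S = [j] := by
  induction js generalizing s with
  | nil => simp [loop]
  | cons k js ih =>
    obtain ⟨h3, h4⟩ := ih (markBucket B S i s k).val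
    simp only [loop, Timed.val_bind, h3, h4, List.mem_cons, forall_eq_or_imp,
      exists_eq_or_imp]
    by_cases hk : k ≤ i
    · obtain ⟨h1, h2⟩ := loop_markClause_val S s (B k)
      simp only [markBucket, hk, if_true, Timed.val_bind, Arr.val_get, h1, h2, and_assoc, or_assoc,
        forall_true_left, true_and]
      exact fun _ => trivial
    · simp [markBucket, hk]

theorem filter_ne_nil_iff {S : Arr n Bool} {c : List (Fin n)} :
    c.filter S ≠ [] ↔ ∃ x ∈ c.toFinset, x ∈ support S := by
  simp [List.filter_eq_nil_iff, mem_support]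

theorem filter_eq_singleton_iff {S : Arr n Bool} {c : List (Fin n)} (hc : c.Nodup) {j : Fin n} :
    c.filter S = [j] ↔ S j = true ∧ j ∈ c.toFinset ∧ ∀ x ∈ c.toFinset, x ∈ support S → x = j := by
  simp only [List.mem_toFinset, mem_support]
  constructor
  · intro h
    have hmem : ∀ x, x ∈ c ∧ S x = true ↔ x = j := fun x => by
      rw [← List.mem_filter, h, List.mem_singleton]
    exact ⟨((hmem j).2 rfl).2, ((hmem j).2 rfl).1, fun x hx hS => (hmem x).1 ⟨hx, hS⟩⟩
  · rintro ⟨hS, hj, hx⟩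
    refine List.perm_singleton.1 ((List.perm_ext_iff_of_nodup (hc.filter _)
      (List.nodup_singleton j)).2 fun x => ?_)
    rw [List.mem_filter, List.mem_singleton]
    exact ⟨fun h => hx x h.1 h.2, fun h => h ▸ ⟨hj, hS⟩⟩

/-- A nonempty clause has a last variable; an empty clause would be in no bucket. -/
theorem mem_fixed_iff_exists_delta {φ : Finset (Finset (Fin n))} (hne : ∅ ∉ φ) {i : Fin n}
    {c : Finset (Fin n)} : c ∈ fixed φ (i.val + 1) ↔ ∃ k ≤ i, c ∈ delta φ k := by
  rw [mem_fixed]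
  constructor
  · rintro ⟨hc, hlt⟩
    have hcne : c.Nonempty := Finset.nonempty_iff_ne_empty.2 fun h => hne (h ▸ hc)
    exact ⟨c.max' hcne, Nat.lt_succ_iff.1 (hlt _ (c.max'_mem hcne)),
      mem_delta.2 ⟨hc, c.max'_mem hcne, fun j hj => c.le_max' j hj⟩⟩
  · rintro ⟨k, hk, hc⟩
    obtain ⟨hc, -, hle⟩ := mem_delta.1 hc
    exact ⟨hc, fun j hj => Nat.lt_succ_of_le ((hle j hj).trans hk)⟩

/-- The flag records transversality, and `P` marks the variables for which a private clause was
seen; together this is the criterion `minimal_isTransversal_iff`. -/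
theorem isPrime_val {φ : Finset (Finset (Fin n))} (hne : ∅ ∉ φ)
    {B : Arr n (List (List (Fin n)))} (hB : ∀ i, Represents (B i) (delta φ i)) (S : Arr n Bool)
    (i : Fin n) : (isPrime B S i).val = true ↔
      Minimal (IsTransversal (fixed φ (i.val + 1))) (support S) := by
  have hlast : ∀ (js : List (Fin n)) (P : Arr n Bool) (ok : Bool), (loop (fun ok j => do
        let b ← S.get j
        let p ← P.get j
        return ok && (!b || p)) ok js).val = true ↔
      ok = true ∧ ∀ j ∈ js, S j = true → P j = true := by
    intro js P
    induction js with
    | nil => simp [loop]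
    | cons j js ih =>
      intro ok
      simp only [loop, Timed.val_bind, ih]
      cases h : S j <;> simp [h, and_assoc]
  obtain ⟨h1, h2⟩ := loop_markBucket_val B S i (true, fun _ => false) (List.finRange n)
  rw [isPrime_eq]
  simp only [Timed.val_bind, Arr.val_new, hlast, h1, h2, minimal_isTransversal_iff]
  simp only [List.mem_finRange, forall_true_left, true_and, Bool.false_eq_true, false_or,
    ← mem_support (A := S)]
  refine and_congr ?_ (forall₂_congr fun j hj => ?_)
  · simp only [filter_ne_nil_iff, IsTransversal, mem_fixed_iff_exists_delta hne]
    constructor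
    · rintro h d ⟨k, hk, hd⟩
      obtain ⟨c, hc, rfl⟩ := (hB k).exists_mem hd
      exact h k hk c hc
    · exact fun h k hk c hc => h _ ⟨k, hk, (hB k).mem hc⟩
  · simp only [mem_fixed_iff_exists_delta hne]
    constructor
    · rintro ⟨k, hk, c, hc, h⟩
      exact ⟨_, ⟨k, hk, (hB k).mem hc⟩, ((filter_eq_singleton_iff ((hB k).2.1 c hc)).1 h).2⟩
    · rintro ⟨d, ⟨k, hk, hd⟩, h⟩
      obtain ⟨c, hc, rfl⟩ := (hB k).exists_mem hd
      exact ⟨k, hk, c, hc,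
        (filter_eq_singleton_iff ((hB k).2.1 c hc)).2 ⟨mem_support.1 hj, h⟩⟩

theorem isPrime_time_le (B : Arr n (List (List (Fin n)))) (S : Arr n Bool) (i : Fin n) :
    (isPrime B S i).time ≤
      3 + 7 * n + 3 * ((List.finRange n).map fun i => cells (B i)).sum := by
  have h1 := loop_time_le (markBucket B S i) (true, fun _ => false) (List.finRange n)
    (fun k => 2 + 3 * cells (B k)) (by
      intro s k _
      have h := loop_time_le (markClause S) s (B k) (fun c => 2 + 2 * c.length)
        fun s c _ => markClause_time_le S s c
      have h2 := sum_map_le_mul_cells (B k) (fun c => 1 + (2 + 2 * c.length)) 3 fun c => by omega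
      by_cases hk : k ≤ i
      · simp only [markBucket, hk, if_true, Timed.time_bind, Arr.time_get, Arr.val_get]
        omega
      · simp [markBucket, hk])
  have h2 := fun (P : Arr n Bool) ok => loop_time_le (fun ok j => do
        let b ← S.get j
        let p ← P.get j
        return ok && (!b || p)) ok (List.finRange n) (fun _ => 2) (by simp)
  rw [isPrime_eq]
  simp only [Timed.time_bind, Arr.time_new, Arr.val_new]
  have h3 := h2 (loop (markBucket B S i) (true, fun _ => false) (List.finRange n)).val.2
    (loop (markBucket B S i) (true, fun _ => false) (List.finRange n)).val.1
  simp only [List.sum_map_add, List.sum_map_mul_left, List.map_const', List.sum_replicate,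
    List.length_finRange, smul_eq_mul] at h1 h3
  omega

/-! ### One pass of the main loop -/

theorem loop_queue_spec {α : Type} (g : Tree → α → Timed Tree) (P : α → Arr n Bool → Prop)
    (js : List (Fin n)) (l : List α)
    (hg : ∀ Q, ∀ a ∈ l, Tree.WF js Q → Tree.WF js (g Q a).val ∧
      ∀ X, Tree.Mem X js (g Q a).val ↔ Tree.Mem X js Q ∨ P a X) (Q : Tree) (hQ : Tree.WF js Q) :
    Tree.WF js (loop g Q l).val ∧
      ∀ X, Tree.Mem X js (loop g Q l).val ↔ Tree.Mem X js Q ∨ ∃ a ∈ l, P a X := by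
  induction l generalizing Q with
  | nil => simp [loop, hQ]
  | cons a l ih =>
    obtain ⟨h1, h2⟩ := hg Q a (by simp) hQ
    obtain ⟨h3, h4⟩ := ih (fun Q b hb => hg Q b (List.mem_cons_of_mem _ hb)) _ h1
    refine ⟨h3, fun X => ?_⟩
    simp only [loop, Timed.val_bind, h4, h2, List.mem_cons, exists_eq_or_imp, or_assoc]

/-- The body of the inner loop of `process`. -/
def enqueue (B : Arr n (List (List (Fin n)))) (A : Arr n Bool) (i : Fin n) (Q : Tree)
    (r : List (Fin n)) : Timed Tree := do
  let S ← merge A i r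
  if ← isPrime B S i then
    let A' ← complete B (i.val + 1) S
    Tree.insert A' (List.finRange n) Q
  else return Q

/-- The body of the outer loop of `process`. -/
def processVar (B : Arr n (List (List (Fin n))))
    (D : List (List (Fin n)) → Timed (List (List (Fin n)))) (A : Arr n Bool) (Q : Tree)
    (i : Fin n) : Timed Tree := do
  if ← A.get i then
    match ← buildResidual B A i with
    | [] => return Q
    | c :: Γ =>
        let ρ ← D (c :: Γ)
        loop (enqueue B A i) Q ρ
  else return Q

theorem process_eq (B : Arr n (List (List (Fin n))))
    (D : List (List (Fin n)) → Timed (List (List (Fin n)))) (A : Arr n Bool) (Q : Tree) :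
    process B D A Q = loop (processVar B D A) Q (List.finRange n) := rfl

theorem enqueue_spec {φ : Finset (Finset (Fin n))} (hne : ∅ ∉ φ)
    {B : Arr n (List (List (Fin n)))} (hB : ∀ i, Represents (B i) (delta φ i)) (A : Arr n Bool)
    (i : Fin n) (hres : (residual φ i (support A)).Nonempty) (Q : Tree)
    (hQ : Tree.WF (List.finRange n) Q) (r : List (Fin n))
    (hr : r.toFinset ∈ rho φ (support A) i) :
    Tree.WF (List.finRange n) (enqueue B A i Q r).val ∧
      ∀ X, Tree.Mem X (List.finRange n) (enqueue B A i Q r).val ↔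
        Tree.Mem X (List.finRange n) Q ∨ GeneratesVia φ (support A) i r.toFinset (support X) := by
  have hS := support_merge_val A i r
  have hp := isPrime_val hne hB (merge A i r).val i
  have hc := complete_val hB (i.val + 1) (merge A i r).val fun j hj => by
    by_contra h
    rw [Bool.not_eq_false, ← mem_support, hS, Finset.mem_union, Finset.mem_filter] at h
    have : j < i := h.elim (·.2) fun h => (lt_and_notMem_of_mem_rho hr h).1
    have : j.val < i.val := this
    omega
  rw [hS] at hp hc
  rw [enqueue, Timed.val_bind, Timed.val_bind]
  split_ifs with h
  · rw [Timed.val_bind]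
    refine ⟨Tree.wf_insert _ _ _ hQ, fun X => ?_⟩
    rw [Tree.mem_insert _ _ _ _ hQ]
    refine or_congr_right ⟨fun hX => ?_, fun hX => ?_⟩
    · have : X = (complete B (i.val + 1) (merge A i r).val).val :=
        funext fun j => hX j (List.mem_finRange j)
      exact ⟨hres, hp.1 h, this ▸ hc⟩
    -- Uniqueness of completions identifies `X` with the vector that is inserted.
    · intro j _
      rw [support_injective (hX.2.2.eq hc)]
  · refine ⟨hQ, fun X => ?_⟩
    exact ⟨Or.inl, fun hX => hX.resolve_right fun hX => h (hp.2 hX.2.1)⟩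

theorem processVar_spec {φ : Finset (Finset (Fin n))} (hne : ∅ ∉ φ)
    {B : Arr n (List (List (Fin n)))} (hB : ∀ i, Represents (B i) (delta φ i))
    {D : List (List (Fin n)) → Timed (List (List (Fin n)))} (A : Arr n Bool) (i : Fin n)
    (hD : i ∈ support A → (residual φ i (support A)).Nonempty → ∀ Γ,
      Represents Γ (residual φ i (support A)) → Represents (D Γ).val (rho φ (support A) i))
    (Q : Tree) (hQ : Tree.WF (List.finRange n) Q) :
    Tree.WF (List.finRange n) (processVar B D A Q i).val ∧
      ∀ X, Tree.Mem X (List.finRange n) (processVar B D A Q i).val ↔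
        Tree.Mem X (List.finRange n) Q ∨ (i ∈ support A ∧ ∃ r ∈ rho φ (support A) i,
          GeneratesVia φ (support A) i r (support X)) := by
  rw [processVar, Timed.val_bind, Arr.val_get]
  by_cases hi : A i = true
  swap
  · simp [hi, hQ, mem_support]
  have hi' := mem_support.2 hi
  have hΓ := buildResidual_val hB A i
  rw [if_pos hi, Timed.val_bind]
  rcases h : (buildResidual B A i).val with _ | ⟨c, Γ⟩
  · rw [h] at hΓ
    have hemp : residual φ i (support A) = ∅ := by rw [← hΓ.2.2]; rfl
    refine ⟨hQ, fun X => ⟨Or.inl, fun hX => hX.resolve_right ?_⟩⟩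
    rintro ⟨-, r, -, hres, -⟩
    rw [hemp] at hres
    exact Finset.not_nonempty_empty hres
  · rw [h] at hΓ
    have hres : (residual φ i (support A)).Nonempty := ⟨_, hΓ.mem (by simp : c ∈ c :: Γ)⟩
    have hρ := hD hi' hres _ hΓ
    simp only [Timed.val_bind]
    obtain ⟨h1, h2⟩ := loop_queue_spec (enqueue B A i)
      (fun r X => GeneratesVia φ (support A) i r.toFinset (support X)) (List.finRange n)
      (D (c :: Γ)).val (fun Q r hr hQ => enqueue_spec hne hB A i hres Q hQ r (hρ.mem hr)) Q hQ
    refine ⟨h1, fun X => (h2 X).trans (or_congr_right ⟨?_, ?_⟩)⟩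
    · rintro ⟨r, hr, hX⟩
      exact ⟨hi', _, hρ.mem hr, hX⟩
    · rintro ⟨-, r, hr, hX⟩
      obtain ⟨r', hr', rfl⟩ := hρ.exists_mem hr
      exact ⟨r', hr', hX⟩

theorem process_spec {φ : Finset (Finset (Fin n))} (hne : ∅ ∉ φ)
    {B : Arr n (List (List (Fin n)))} (hB : ∀ i, Represents (B i) (delta φ i))
    {D : List (List (Fin n)) → Timed (List (List (Fin n)))} (A : Arr n Bool)
    (hD : ∀ i ∈ support A, (residual φ i (support A)).Nonempty → ∀ Γ,
      Represents Γ (residual φ i (support A)) → Represents (D Γ).val (rho φ (support A) i))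
    (Q : Tree) (hQ : Tree.WF (List.finRange n) Q) :
    Tree.WF (List.finRange n) (process B D A Q).val ∧
      ∀ X, Tree.Mem X (List.finRange n) (process B D A Q).val ↔
        Tree.Mem X (List.finRange n) Q ∨ Generates φ (support A) (support X) := by
  rw [process_eq]
  obtain ⟨h1, h2⟩ := loop_queue_spec (processVar B D A) (fun i X => i ∈ support A ∧
    ∃ r ∈ rho φ (support A) i, GeneratesVia φ (support A) i r (support X)) (List.finRange n)
    (List.finRange n) (fun Q i _ => processVar_spec hne hB A i (hD i) Q) Q hQ
  refine ⟨h1, fun X => (h2 X).trans ?_⟩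
  simp [Generates]

/-- `37 = 9 + 16 + 9 + 3`, for merging, the primality test, completion and insertion. -/
theorem enqueue_time_le (B : Arr n (List (List (Fin n)))) (A : Arr n Bool) (i : Fin n) (Q : Tree)
    (r : List (Fin n)) (hr : r.Nodup) {N : ℕ} (hn : n ≤ N) (h1 : 1 ≤ N)
    (hcells : ((List.finRange n).map fun i => cells (B i)).sum ≤ 2 * N) :
    (enqueue B A i Q r).time ≤ 37 * N := by
  have ha := merge_time_le A i r
  have hb := isPrime_time_le B (merge A i r).val i
  have hc := complete_time_le B (i.val + 1) (merge A i r).val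
  have hd := Tree.insert_time_le (complete B (i.val + 1) (merge A i r).val).val (List.finRange n) Q
  have he : r.length ≤ n := by simpa using hr.length_le_card
  rw [List.length_finRange] at hd
  rw [enqueue, Timed.time_bind, Timed.time_bind]
  split_ifs
  · rw [Timed.time_bind]
    omega
  · rw [Timed.time_pure]
    omega

/-- The `4` is one array access, two for `buildResidual` and one for the end of the loop over `ρ`;
`38` is `37` plus the charge for a pass of that loop, as `1 ≤ N`. -/
theorem processVar_time_le {φ : Finset (Finset (Fin n))} {B : Arr n (List (List (Fin n)))}
    (hB : ∀ i, Represents (B i) (delta φ i))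
    {D : List (List (Fin n)) → Timed (List (List (Fin n)))} (A : Arr n Bool) (i : Fin n) (τ : ℕ)
    (hD : i ∈ support A → (residual φ i (support A)).Nonempty → ∀ Γ,
      Represents Γ (residual φ i (support A)) → Represents (D Γ).val (rho φ (support A) i) ∧
        (D Γ).time ≤ τ) (Q : Tree) {N : ℕ} (hn : n ≤ N) (h1 : 1 ≤ N)
    (hcells : ((List.finRange n).map fun i => cells (B i)).sum ≤ 2 * N) :
    (processVar B D A Q i).time ≤ 4 + 2 * cells (B i) +
      if i ∈ support A then τ + (rho φ (support A) i).card * (38 * N) else 0 := by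
  rw [processVar, Timed.time_bind, Arr.val_get, Arr.time_get]
  by_cases hi : A i = true
  swap
  · simp [hi, mem_support]
    omega
  have hi' := mem_support.2 hi
  have hΓ := buildResidual_val hB A i
  have ht := buildResidual_time_le B A i
  rw [if_pos hi, if_pos hi', Timed.time_bind]
  rcases h : (buildResidual B A i).val with _ | ⟨c, Γ⟩
  · simp only [Timed.time_pure]
    omega
  · rw [h] at hΓ
    have hres : (residual φ i (support A)).Nonempty := ⟨_, hΓ.mem (by simp : c ∈ c :: Γ)⟩
    obtain ⟨hρ, hτ⟩ := hD hi' hres _ hΓ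
    have hl := loop_time_le (enqueue B A i) Q (D (c :: Γ)).val (fun _ => 37 * N) fun Q r hr =>
      enqueue_time_le B A i Q r (hρ.2.1 r hr) hn h1 hcells
    rw [List.map_const', List.sum_replicate, smul_eq_mul, hρ.length_eq_card] at hl
    have hmul : (rho φ (support A) i).card * (1 + 37 * N) ≤
      (rho φ (support A) i).card * (38 * N) := Nat.mul_le_mul_left _ (by omega)
    simp only [Timed.time_bind]
    omega

theorem process_time_le {φ : Finset (Finset (Fin n))} {B : Arr n (List (List (Fin n)))}
    (hB : ∀ i, Represents (B i) (delta φ i))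
    {D : List (List (Fin n)) → Timed (List (List (Fin n)))} (A : Arr n Bool)
    (T : Finset (Fin n) → Fin n → ℕ)
    (hD : ∀ i ∈ support A, (residual φ i (support A)).Nonempty → ∀ Γ,
      Represents Γ (residual φ i (support A)) → Represents (D Γ).val (rho φ (support A) i) ∧
        (D Γ).time ≤ T (support A) i) (Q : Tree) (hn : n ≤ length φ) (h1 : 1 ≤ length φ)
    (hcells : ((List.finRange n).map fun i => cells (B i)).sum ≤ 2 * length φ) :
    (process B D A Q).time ≤ passBound φ T 38 (support A) + 10 * length φ := by
  rw [process_eq]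
  have h := loop_time_le (processVar B D A) Q (List.finRange n) _ fun Q i _ =>
    processVar_time_le hB A i (T (support A) i) (hD i) Q hn h1 hcells
  have hsum : passBound φ T 38 (support A) = ((List.finRange n).map fun i =>
      if i ∈ support A then T (support A) i + (rho φ (support A) i).card * (38 * length φ)
      else 0).sum := by
    rw [passBound, ← Fin.sum_univ_def, ← Finset.sum_filter, Finset.filter_mem_eq_inter,
      Finset.univ_inter]
  simp only [List.sum_map_add, List.sum_map_mul_left, List.map_const', List.sum_replicate,
    List.length_finRange, smul_eq_mul, ← hsum] at h
  omega

/-! ### The main loop -/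

theorem emit_time_le (Q : Tree) : (emit n Q).time ≤ 4 * n + 3 := by
  have h := Tree.popMin_time_le (List.finRange n) Q fun _ => false
  rw [List.length_finRange] at h
  simp only [emit, Timed.time_bind, Arr.time_new, Arr.val_new, time_charge, Timed.time_pure]
  omega

theorem emit_val (Q : Tree) :
    (emit n Q).val = (Tree.popMin (List.finRange n) Q fun _ => false).val := rfl

/-- Induction on the set `R` of terms still to be printed. Invariant: `R` is closed upwards in
weight, the queue lies in `R`, and each member of `R` is queued or generated by a member of `R`. In
the delay claim, `a` is the time of the previous output (or the start). -/
theorem exists_loop {φ : Finset (Finset (Fin n))} (hne : ∅ ∉ φ)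
    {B : Arr n (List (List (Fin n)))} (hB : ∀ i, Represents (B i) (delta φ i))
    {D : List (List (Fin n)) → Timed (List (List (Fin n)))}
    (hD : ∀ t, Minimal (IsTransversal φ) t → ∀ i ∈ t, (residual φ i t).Nonempty → ∀ Γ,
      Represents Γ (residual φ i t) → Represents (D Γ).val (rho φ t i))
    (e : ℕ) (he : ∀ Q, (emit n Q).time ≤ e) (p : Finset (Fin n) → ℕ)
    (hp : ∀ A Q, Minimal (IsTransversal φ) (support A) → (process B D A Q).time ≤ p (support A))
    (R : Finset (Finset (Fin n))) (hR : ∀ t ∈ R, Minimal (IsTransversal φ) t)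
    (hup : ∀ s ∈ R, ∀ u, Minimal (IsTransversal φ) u → weight s < weight u → u ∈ R)
    (Q : Tree) (hQ : Tree.WF (List.finRange n) Q)
    (hQR : ∀ X, Tree.Mem X (List.finRange n) Q → support X ∈ R)
    (hcov : ∀ t ∈ R, (∃ X, support X = t ∧ Tree.Mem X (List.finRange n) Q) ∨
      ∃ s ∈ R, Generates φ s t) (clock : ℕ) :
    ∃ (out : List (ℕ × Finset (Fin n))) (total : ℕ),
      Loop B D Q clock out total ∧
      (out.map Prod.snd).Pairwise (fun s t => weight s < weight t) ∧
      (∀ t, t ∈ out.map Prod.snd ↔ t ∈ R) ∧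
      total ≤ clock + 1 + ∑ t ∈ R, (e + p t) ∧
      ∀ M a, (∀ t ∈ R, e + p t + 1 ≤ M) → clock + e + 1 ≤ a + M →
        List.IsChain (fun a b => b ≤ a + M) ((a :: out.map Prod.fst) ++ [total]) := by
  induction R using Finset.strongInduction generalizing Q clock with
  | H R ih =>
    by_cases hQe : Q = .empty
    · subst hQe
      -- The smallest member of `R` cannot be generated within `R`, so it would be queued.
      have hRe : R = ∅ := by
        by_contra hRne
        obtain ⟨t, ht, hmin⟩ := R.exists_min_image weight (Finset.nonempty_iff_ne_empty.2 hRne)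
        rcases hcov t ht with ⟨X, -, hX⟩ | ⟨s, hs, hst⟩
        · exact Tree.not_mem_empty _ _ hX
        · exact (hmin s hs).not_gt hst.weight_lt
      subst hRe
      refine ⟨[], clock + 1, Loop.halt clock, by simp, by simp, by simp, fun M a _ h => ?_⟩
      simp
      omega
    have hpop := Tree.popMin_spec (List.finRange n) (List.nodup_finRange n) Q hQ hQe (fun _ => false)
      fun _ _ => rfl
    rw [← emit_val] at hpop
    set A := (emit n Q).val.1
    set Q₁ := (emit n Q).val.2
    have htR : support A ∈ R := hQR A hpop.mem
    have htmin := hR _ htR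
    -- The popped term is the minimum of all of `R`, not only of the queue: following generators
    -- back from `u` lowers the weight until a queued term is reached.
    have hle : ∀ m, ∀ u ∈ R, weight u = m → u = support A ∨ weight (support A) < weight u := by
      intro m
      induction m using Nat.strong_induction_on with
      | _ m ihm =>
        rintro u hu rfl
        rcases hcov u hu with ⟨X, rfl, hX⟩ | ⟨s, hs, hsu⟩
        · refine (hpop.le X hX).imp (fun h => ?_) fun h => h.weight_lt
          exact congrArg support (funext fun j => h j (List.mem_finRange j))
        · rcases ihm _ hsu.weight_lt s hs rfl with rfl | h
          · exact Or.inr hsu.weight_lt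
          · exact Or.inr (h.trans hsu.weight_lt)
    obtain ⟨hwf, hmem⟩ := process_spec hne hB A (hD _ htmin) Q₁ hpop.wf
    obtain ⟨out, total, hloop, hsort, hout, htotal, hchain⟩ := ih (R.erase (support A))
      (Finset.erase_ssubset htR) (fun t ht => hR t (Finset.mem_of_mem_erase ht))
      (fun s hs u hu hsu => Finset.mem_erase.2 ⟨fun h => by
          obtain ⟨hne, hs⟩ := Finset.mem_erase.1 hs
          have := (hle _ s hs rfl).resolve_left hne
          rw [h] at hsu
          exact this.not_gt hsu, hup s (Finset.mem_of_mem_erase hs) u hu hsu⟩)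
      (process B D A Q₁).val hwf
      (fun X hX => by
        rcases (hmem X).1 hX with hX | hX
        · obtain ⟨hX, j, -, hj⟩ := (hpop.mem_iff X).1 hX
          exact Finset.mem_erase.2 ⟨fun h => hj (by rw [support_injective h]), hQR X hX⟩
        · exact Finset.mem_erase.2 ⟨fun h => hX.weight_lt.ne (by rw [h]),
            hup _ htR _ hX.minimal hX.weight_lt⟩)
      -- A term whose generator was just processed is now queued; every other one keeps its place in
      -- the queue or its generator.
      (fun t ht => by
        obtain ⟨hne, ht⟩ := Finset.mem_erase.1 ht
        have hgen : Generates φ (support A) t → ∃ X, support X = t ∧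
            Tree.Mem X (List.finRange n) (process B D A Q₁).val := by
          intro h
          have hs : support (fun j => decide (j ∈ t)) = t := by ext; simp [mem_support]
          exact ⟨_, hs, (hmem _).2 (Or.inr (by rwa [hs]))⟩
        rcases hcov t ht with ⟨X, rfl, hX⟩ | ⟨s, hs, hst⟩
        · refine Or.inl ⟨X, rfl, (hmem X).2 (Or.inl ((hpop.mem_iff X).2 ⟨hX, ?_⟩))⟩
          by_contra! hcon
          exact hne (congrArg support (funext fun j => hcon j (List.mem_finRange j)))
        · by_cases hsA : s = support A
          · exact Or.inl (hgen (hsA ▸ hst))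
          · exact Or.inr ⟨s, Finset.mem_erase.2 ⟨hsA, hs⟩, hst⟩)
      (clock + (emit n Q).time + (process B D A Q₁).time)
    have hproc := hp A Q₁ htmin
    have hemit := he Q
    refine ⟨(clock + (emit n Q).time, support A) :: out, total, Loop.pass Q clock out total hQe hloop,
      ?_, fun t => ?_, ?_, fun M a hM hclock => ?_⟩
    · rw [List.map_cons, List.pairwise_cons]
      refine ⟨fun u hu => ?_, hsort⟩
      obtain ⟨hne, hu⟩ := Finset.mem_erase.1 ((hout u).1 hu)
      exact (hle _ u hu rfl).resolve_left hne
    · rw [List.map_cons, List.mem_cons, hout, Finset.mem_erase]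
      by_cases h : t = support A
      · simp [h, htR]
      · simp [h]
    · rw [← Finset.add_sum_erase _ _ htR]
      omega
    · have hMA := hM _ htR
      have := hchain M (clock + (emit n Q).time) (fun t ht => hM t (Finset.mem_of_mem_erase ht))
        (by omega)
      rw [List.map_cons, List.cons_append, List.cons_append, List.isChain_cons_cons]
      exact ⟨by dsimp only; omega, this⟩

/-! ### Preprocessing and the length of the formula -/

theorem le_length {φ : Finset (Finset (Fin n))} (hφ : ∀ j : Fin n, ∃ c ∈ φ, j ∈ c) :
    n ≤ length φ := by
  calc n = (Finset.univ : Finset (Fin n)).card := (Finset.card_fin n).symm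
    _ ≤ (φ.biUnion id).card := Finset.card_le_card fun j _ => by simpa using hφ j
    _ ≤ length φ := Finset.card_biUnion_le

theorem start_time_le (L : List (List (Fin n))) : (start L).time ≤ 8 * n + 5 + 6 * cells L := by
  have h1 := buckets_time_le L
  have h2 := complete_time_le (buckets L).val 0 fun _ => false
  have h3 := sum_cells_buckets_le L
  have h4 := Tree.insert_time_le (complete (buckets L).val 0 fun _ => false).val (List.finRange n) .empty
  rw [List.length_finRange] at h4
  simp only [start, Timed.time_bind, Arr.time_new, Arr.val_new, Timed.time_pure]
  omega

theorem support_false : support (fun _ : Fin n => false) = ∅ := by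
  ext
  simp [mem_support]

theorem minimal_of_isCompletion_empty {φ : Finset (Finset (Fin n))} (hne : ∅ ∉ φ)
    {t : Finset (Fin n)} (ht : IsCompletion φ 0 ∅ t) : Minimal (IsTransversal φ) t := by
  refine minimal_iff_prefixMin.2 (ht.prefixMin ⟨fun c hc => ?_, by simp⟩ (Nat.zero_le n) le_rfl)
  obtain ⟨hc, hlt⟩ := mem_fixed.1 hc
  obtain ⟨j, hj⟩ := Finset.nonempty_iff_ne_empty.2 fun h => hne (h ▸ hc)
  exact absurd (hlt j hj) (Nat.not_lt_zero _)

theorem exists_dualizeRun {φ : Finset (Finset (Fin n))} (hne : ∅ ∉ φ) {L : List (List (Fin n))}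
    (hL : Represents L φ) {D : List (List (Fin n)) → Timed (List (List (Fin n)))}
    (hD : ∀ t, Minimal (IsTransversal φ) t → ∀ i ∈ t, (residual φ i t).Nonempty → ∀ Γ,
      Represents Γ (residual φ i t) → Represents (D Γ).val (rho φ t i))
    (e : ℕ) (he : ∀ Q, (emit n Q).time ≤ e) (p : Finset (Fin n) → ℕ)
    (hp : ∀ A Q, Minimal (IsTransversal φ) (support A) →
      (process (buckets L).val D A Q).time ≤ p (support A)) :
    ∃ (out : List (ℕ × Finset (Fin n))) (total : ℕ),
      DualizeRun L D out total ∧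
      (out.map Prod.snd).Pairwise (fun s t => weight s < weight t) ∧
      (∀ t, t ∈ out.map Prod.snd ↔ t ∈ primeImplicants (cnfFun φ)) ∧
      total ≤ (start L).time + 1 + ∑ t ∈ primeImplicants (cnfFun φ), (e + p t) ∧
      ∀ M, (∀ t ∈ primeImplicants (cnfFun φ), e + p t + 1 ≤ M) → (start L).time + e + 1 ≤ M →
        DelayAtMost M out total := by
  have hcomp := complete_val (represents_buckets hL) 0 (fun _ => false) fun _ _ => rfl
  rw [support_false] at hcomp
  have hmem : ∀ X, Tree.Mem X (List.finRange n) (start L).val.2 ↔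
      X = (complete (buckets L).val 0 fun _ => false).val := by
    intro X
    simp only [start, Timed.val_bind, Arr.val_new, Timed.val_pure]
    rw [Tree.mem_insert _ _ _ _ (Tree.wf_empty _)]
    simp only [Tree.not_mem_empty, List.mem_finRange, forall_true_left, false_or]
    exact funext_iff.symm
  obtain ⟨out, total, h1, h2, h3, h4, h5⟩ := exists_loop hne (represents_buckets hL) hD e he p hp
    (primeImplicants (cnfFun φ)) (fun t ht => mem_primeImplicants_cnfFun.1 ht)
    (fun _ _ u hu _ => mem_primeImplicants_cnfFun.2 hu) (start L).val.2
    (Tree.wf_insert _ _ _ (Tree.wf_empty _))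
    (fun X hX => by
      rw [(hmem X).1 hX]
      exact mem_primeImplicants_cnfFun.2 (minimal_of_isCompletion_empty hne hcomp))
    (fun t ht => by
      rcases isCompletion_empty_or_exists_generates (mem_primeImplicants_cnfFun.1 ht) with h | h
      · exact Or.inl ⟨_, hcomp.eq h, (hmem _).2 rfl⟩
      · obtain ⟨s, hs, hst⟩ := h
        exact Or.inr ⟨s, mem_primeImplicants_cnfFun.2 hs, hst⟩) (start L).time
  exact ⟨out, total, h1, h2, h3, h4, fun M hM hs => h5 M 0 hM (by omega)⟩

/-! ### The bounds -/

theorem passBound_add (φ : Finset (Finset (Fin n))) (T : Finset (Fin n) → Fin n → ℕ) (C C' : ℕ)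
    (t : Finset (Fin n)) : passBound φ T (C + C') t =
      passBound φ T C t + (∑ i ∈ t, (rho φ t i).card) * (C' * length φ) := by
  rw [passBound, passBound, Finset.sum_mul, ← Finset.sum_add_distrib]
  exact Finset.sum_congr rfl fun i _ => by ring

theorem IsPrimeCNF.eq_of_subset {f : (Fin n → Bool) → Bool} {φ : Finset (Finset (Fin n))}
    (hφ : IsPrimeCNF f φ) {c d : Finset (Fin n)} (hc : c ∈ φ) (hd : d ∈ φ) (hdc : d ⊆ c) : d = c :=
  hdc.antisymm (((hφ c).1 hc).2 ((hφ d).1 hd).1 hdc)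

/-- Let `t` hit `c` in `x_i`. The clause `{x_i}` cannot be in `φ`, as it would be properly contained
in the prime `c`. So `Δ^i[t]` has no empty clause, is not `0`, and has a prime implicant. -/
theorem one_le_sum_card_rho {f : (Fin n → Bool) → Bool} {φ : Finset (Finset (Fin n))}
    (hφ : IsPrimeCNF f φ) {c : Finset (Fin n)} (hc : c ∈ φ) (hcard : 2 ≤ c.card)
    {t : Finset (Fin n)} (ht : IsTransversal φ t) : 1 ≤ ∑ i ∈ t, (rho φ t i).card := by
  obtain ⟨i, hic, hit⟩ := ht c hc
  have htr : IsTransversal (residual φ i t) Finset.univ := by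
    rw [isTransversal_residual_iff]
    intro d hd _
    obtain ⟨hdφ, hid, hle⟩ := mem_delta.1 hd
    by_contra! hcon
    have hdi : d ⊆ {i} := fun x hx => Finset.mem_singleton.2
      ((hle x hx).lt_or_eq.resolve_left fun h => hcon x hx h (Finset.mem_univ x))
    have hdc := hφ.eq_of_subset hc hdφ (hdi.trans (Finset.singleton_subset_iff.2 hic))
    have := Finset.card_le_card hdi
    rw [Finset.card_singleton, hdc] at this
    omega
  obtain ⟨r, -, hr⟩ := htr.exists_minimal
  calc 1 ≤ (rho φ t i).card := Finset.card_pos.2 ⟨r, mem_rho.2 hr⟩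
    _ ≤ ∑ i ∈ t, (rho φ t i).card :=
      Finset.single_le_sum (f := fun i => (rho φ t i).card) (fun _ _ => Nat.zero_le _) hit

theorem isTransversal_univ {φ : Finset (Finset (Fin n))} (hne : ∅ ∉ φ) :
    IsTransversal φ Finset.univ := by
  intro c hc
  obtain ⟨j, hj⟩ := Finset.nonempty_iff_ne_empty.2 fun h => hne (h ▸ hc)
  exact ⟨j, hj, Finset.mem_univ j⟩

theorem eq_univ_of_forall_card_eq_one {φ : Finset (Finset (Fin n))}
    (hφ : ∀ j : Fin n, ∃ c ∈ φ, j ∈ c) (h1 : ∀ c ∈ φ, c.card = 1) {t : Finset (Fin n)}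
    (ht : IsTransversal φ t) : t = Finset.univ := by
  rw [Finset.eq_univ_iff_forall]
  intro j
  obtain ⟨c, hc, hj⟩ := hφ j
  obtain ⟨a, rfl⟩ := Finset.card_eq_one.1 (h1 c hc)
  obtain ⟨x, hx, hxt⟩ := ht _ hc
  rw [Finset.mem_singleton] at hx hj
  rwa [hj, ← hx]

end Dualization

theorem mainTheorem6 :
    ∃ C : ℕ, ∀ (n : ℕ) (_ : 0 < n) (f : (Fin n → Bool) → Bool) (_ : Monotone f)
      (φ : Finset (Finset (Fin n))) (_ : Dualization.IsPrimeCNF f φ)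
      (_ : ∀ j : Fin n, ∃ c ∈ φ, j ∈ c)
      (L : List (List (Fin n))) (_ : Dualization.Represents L φ)
      (D : List (List (Fin n)) → Dualization.Timed (List (List (Fin n))))
      (T : Finset (Fin n) → Fin n → ℕ)
      (_ : ∀ t ∈ Dualization.primeImplicants f, ∀ i ∈ t, (Dualization.residual φ i t).Nonempty →
        ∀ Γ : List (List (Fin n)), Dualization.Represents Γ (Dualization.residual φ i t) →
          Dualization.Represents (D Γ).val (Dualization.rho φ t i) ∧ (D Γ).time ≤ T t i),
      ∃ (out : List (ℕ × Finset (Fin n))) (total : ℕ),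
        Dualization.DualizeRun L D out total ∧
        (out.map Prod.snd).Pairwise (fun s t => Dualization.weight s < Dualization.weight t) ∧
        (∀ t, t ∈ out.map Prod.snd ↔ t ∈ Dualization.primeImplicants f) ∧
        ((∃ c ∈ φ, 2 ≤ c.card) →
          Dualization.DelayAtMost
            ((Dualization.primeImplicants f).sup (Dualization.passBound φ T C)) out total ∧
          total ≤ ∑ t ∈ Dualization.primeImplicants f, Dualization.passBound φ T C t) ∧
        ((∀ c ∈ φ, c.card = 1) →
          Dualization.DelayAtMost
            ((Dualization.primeImplicants f).sup (Dualization.passBound φ T C)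
              + C * Dualization.length φ) out total ∧
          total ≤ ∑ t ∈ Dualization.primeImplicants f, Dualization.passBound φ T C t
              + C * Dualization.length φ) ∧
        (∀ t ∈ Dualization.primeImplicants f, ∀ i ∈ t,
          (Dualization.rho φ t i).card ≤ (Dualization.primeImplicants f).card) := by
  open Dualization in
  -- `38‖φ‖` pays for each term of `ρ`. The overhead is at most `25‖φ‖` for the start, `7‖φ‖` for
  -- printing and `10‖φ‖` for the rest of a pass, plus one step for halting; `50‖φ‖` covers it.
  refine ⟨38 + 50, fun n hn f hf φ hφ hocc L hL D T hD => ?_⟩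
  have hne : ∅ ∉ φ := by
    intro h
    obtain ⟨c, hc, hj⟩ := hocc ⟨0, hn⟩
    rw [← hφ.eq_of_subset hc h (Finset.empty_subset c)] at hj
    exact Finset.notMem_empty _ hj
  have hfφ := hφ.eq_cnfFun hf
  rw [hfφ] at hD ⊢
  have hPI : ∀ {t}, t ∈ primeImplicants (cnfFun φ) ↔ Minimal (IsTransversal φ) t :=
    mem_primeImplicants_cnfFun
  have hnN := le_length hocc
  have hN : 1 ≤ length φ := hn.trans_le hnN
  have hcells := hL.cells_le hne
  have hsum := sum_cells_buckets_le L
  obtain ⟨out, total, hrun, hsort, hout, htotal, hdelay⟩ := exists_dualizeRun hne hL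
    (fun t ht i hi hres Γ hΓ => (hD t (hPI.2 ht) i hi hres Γ hΓ).1) (7 * length φ)
    (fun Q => (emit_time_le Q).trans (by omega)) (fun t => passBound φ T 38 t + 10 * length φ)
    (fun A Q hA => process_time_le (represents_buckets hL) A T (hD _ (hPI.2 hA)) Q hnN hN
      (hsum.trans hcells))
  have hstart : (start L).time ≤ 25 * length φ := (start_time_le L).trans (by omega)
  refine ⟨out, total, hrun, hsort, hout, ?_, ?_, fun t ht i _ => card_rho_le (hPI.1 ht).1 i⟩
  · rintro ⟨c, hc, hcard⟩
    have hpass : ∀ t ∈ primeImplicants (cnfFun φ),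
        passBound φ T 38 t + 50 * length φ ≤ passBound φ T (38 + 50) t := by
      intro t ht
      rw [passBound_add]
      exact Nat.add_le_add_left
        (Nat.le_mul_of_pos_left _ (one_le_sum_card_rho hφ hc hcard (hPI.1 ht).1)) _
    have hsup : ∀ t ∈ primeImplicants (cnfFun φ), passBound φ T (38 + 50) t ≤
        (primeImplicants (cnfFun φ)).sup (passBound φ T (38 + 50)) := fun t ht => Finset.le_sup ht
    obtain ⟨u, -, hu⟩ := (isTransversal_univ hne).exists_minimal
    have hu := hPI.2 hu
    constructor
    · refine hdelay _ (fun t ht => ?_) ?_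
      · have := hpass t ht
        have := hsup t ht
        omega
      · have := hpass u hu
        have := hsup u hu
        omega
    -- Each prime implicant has `50‖φ‖` to spare and uses `17‖φ‖` in its own pass; as there is at
    -- least one, the remainder covers the `26‖φ‖` for start and halt.
    · have h1 := Finset.sum_le_sum hpass
      have h2 : 1 ≤ (primeImplicants (cnfFun φ)).card := Finset.card_pos.2 ⟨u, hu⟩
      have h3 := Nat.mul_le_mul_right (26 * length φ) h2
      simp only [Finset.sum_add_distrib, Finset.sum_const, smul_eq_mul] at h1 htotal
      nlinarith
  · intro h1
    have hpass : ∀ t, passBound φ T 38 t ≤ passBound φ T (38 + 50) t := fun t => by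
      rw [passBound_add]
      exact Nat.le_add_right _ _
    constructor
    · refine hdelay _ (fun t ht => ?_) (by omega)
      have := hpass t
      have : passBound φ T (38 + 50) t ≤
        (primeImplicants (cnfFun φ)).sup (passBound φ T (38 + 50)) := Finset.le_sup ht
      omega
    -- When all clauses are single variables, the only transversal is the full term, so the pass
    -- overhead of `17‖φ‖` arises at most once.
    · have h2 : (primeImplicants (cnfFun φ)).card ≤ 1 := Finset.card_le_one.2 fun s hs t ht => by
        rw [eq_univ_of_forall_card_eq_one hocc h1 (hPI.1 hs).1,
          eq_univ_of_forall_card_eq_one hocc h1 (hPI.1 ht).1]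
      have h3 := Nat.mul_le_mul_right (17 * length φ) h2
      have h4 := Finset.sum_le_sum fun t (_ : t ∈ primeImplicants (cnfFun φ)) => hpass t
      simp only [Finset.sum_add_distrib, Finset.sum_const, smul_eq_mul] at htotal
      nlinarith
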